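/- Let $N\in\mathbb N$. Let $C(O_N^+)$ be the universal unital $C^*$-algebra generated by the entries of an $N\times N$ matrix $u=(u_{ij})$ subject to $u=\bar u$, $u^t=u^{-1}$, and let $C(U_N^+)$ be the universal unital $C^*$-algebra generated by the entries of an $N\times N$ matrix $u=(u_{ij})$ subject to $u^*=u^{-1}$, $u^t=\bar u^{-1}$, where $\bar u=(u_{ij}^*)$. For a colored integer $k=k_1\ldots k_p$, that is, a word in the colors $\circ,\bullet$, of length $|k|=p$, let $u^{\otimes k}$ be the corresponding tensor product of copies of $u^{\otimes\circ}=u$ and $u^{\otimes\bullet}=\bar u$, with $(v\otimes w)_{ia,jb}=v_{ij}w_{ab}$ and $u^{\otimes\emptyset}=1$; and for square matrices $v,w$ of sizes $n,m$ over the algebra, let $Hom(v,w)=\{T\in M_{m\times n}(\mathbb C)\mid Tv=wT\}$. For colored integers $k,l$, let $NC_2(k,l)$ be the set of pairings between an upper row of $|k|$ points and a lower row of $|l|$ points, colored by $k,l$, which can be drawn between the two rows without crossings (the colors play no role here). Let $\mathcal{NC}_2(k,l)\subset NC_2(k,l)$ be the subset of those pairings which are matching, meaning that the strings joining two points of the same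 row join $\circ$ to $\bullet$, and the strings joining an upper point to a lower point join $\circ$ to $\circ$ or $\bullet$ to $\bullet$. For a pairing $\pi$ let $T_\pi:(\mathbb C^N)^{\otimes |k|}\to(\mathbb C^N)^{\otimes |l|}$ be the linear map $$T_\pi(e_{i_1}\otimes\ldots\otimes e_{i_{|k|}})=\sum_{j_1,\ldots,j_{|l|}}\delta_\pi\begin{pmatrix}i_1&\ldots&i_{|k|}\\ j_1&\ldots&j_{|l|}\end{pmatrix}e_{j_1}\otimes\ldots\otimes e_{j_{|l|}},$$ where $\delta_\pi=1$ if all the strings of $\pi$ join equal indices, and $\delta_\pi=0$ otherwise; $T_\pi$ is identified with its matrix in the standard bases. Theorem 4.28 (Brauer theorem for $O_N^+,U_N^+$). For all colored integers $k,l$ we have $$Hom(u^{\otimes k},u^{\otimes l})=span\left(T_\pi\,\middle|\,\pi\in D(k,l)\right),$$ with $D=NC_2$ for $O_N^+$, and with $D=\mathcal{NC}_2$ for $U_N^+$. -/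

import Mathlib

open scoped ENNReal Matrix

noncomputable section

namespace FreeQG

/-! ### Universal C*-algebras given by generators and relations -/

/-- Relations for a family `x : ι → B` of elements of a unital C*-algebra `B`, forcing each `x i` to be
bounded in norm independently of `B` (so that a largest C*-norm exists). -/
structure Relations (ι : Type) where
  Holds : ∀ (B : Type) [CStarAlgebra B], (ι → B) → Prop
  bounded : ∀ i, ∃ C : ℝ, ∀ (B : Type) [CStarAlgebra B] (x : ι → B), Holds B x → ‖x i‖ ≤ C

/-- A realization of the relations `R` by elements of a nonzero unital C*-algebra. C*-algebras in `Type`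
are enough: a C*-algebra generated by countably many elements has at most continuum many elements. -/
structure Realization {ι : Type} (R : Relations ι) where
  B : Type
  [cstar : CStarAlgebra B]
  [nontriv : Nontrivial B]
  x : ι → B
  holds : R.Holds B x

attribute [instance] Realization.cstar Realization.nontriv

/-- The C*-algebra of bounded families indexed by all the realizations of `R`. -/
abbrev BigProduct {ι : Type} (R : Relations ι) : Type 1 :=
  lp (fun ρ : Realization R => ρ.B) ∞

instance {ι : Type} (R : Relations ι) : CStarAlgebra (BigProduct R) where

/-- The generator `i`, whose component in each realization is the `i`-th element of that realization. -/
def bigGen {ι : Type} (R : Relations ι) (i : ι) : BigProduct R :=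
  ⟨fun ρ => ρ.x i, by
    obtain ⟨C, hC⟩ := R.bounded i
    refine memℓp_infty ⟨C, ?_⟩
    rintro _ ⟨ρ, rfl⟩
    exact hC ρ.B ρ.x ρ.holds⟩

/-- The *-subalgebra underlying the universal C*-algebra: the closed *-subalgebra generated by the
`bigGen R i`. The norm of a noncommutative *-polynomial in the generators is the supremum of the norms of
its values in all the realizations, so this is the completion for the largest C*-norm. -/
def univSubalgebra {ι : Type} (R : Relations ι) : StarSubalgebra ℂ (BigProduct R) :=
  (StarAlgebra.adjoin ℂ (Set.range (bigGen R))).topologicalClosure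

/-- The universal unital C*-algebra generated by elements `x i`, `i : ι`, subject to `R`. -/
def UnivCStar {ι : Type} (R : Relations ι) : Type 1 := univSubalgebra R

instance {ι : Type} (R : Relations ι) : CStarAlgebra (UnivCStar R) :=
  StarSubalgebra.cstarAlgebra (univSubalgebra R)
    (h_closed := StarSubalgebra.isClosed_topologicalClosure _)

/-- The generators of the universal C*-algebra. -/
def UnivCStar.gen {ι : Type} (R : Relations ι) (i : ι) : UnivCStar R :=
  ⟨bigGen R i, StarSubalgebra.le_topologicalClosure _
    (StarAlgebra.subset_adjoin ℂ _ (Set.mem_range_self i))⟩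

/-! ### The algebras of continuous functions on the free orthogonal and free unitary quantum groups -/

/-- `u` is biunitary: `u* = u⁻¹` and `uᵗ = ū⁻¹`, where `ū` has the entries `star (u i j)`. -/
def IsBiunitary {n B : Type*} [Fintype n] [DecidableEq n] [Ring B] [StarRing B]
    (u : Matrix n n B) : Prop :=
  (uᴴ * u = 1 ∧ u * uᴴ = 1) ∧ (uᵀ * u.map star = 1 ∧ u.map star * uᵀ = 1)

/-- `u` is orthogonal: `u = ū` and `uᵗ = u⁻¹`. -/
def IsOrthogonal {n B : Type*} [Fintype n] [DecidableEq n] [Ring B] [StarRing B]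
    (u : Matrix n n B) : Prop :=
  u = u.map star ∧ (uᵀ * u = 1 ∧ u * uᵀ = 1)

theorem norm_entry_le_one {n B : Type*} [Fintype n] [DecidableEq n] [CStarAlgebra B]
    (u : Matrix n n B) (h : u * uᴴ = 1) (i j : n) : ‖u i j‖ ≤ 1 := by
  let _ := CStarAlgebra.spectralOrder B
  have := CStarAlgebra.spectralOrderedRing B
  have h1 : ∑ k, u i k * star (u i k) = 1 := by
    have := congrFun (congrFun h i) i
    simpa [Matrix.mul_apply] using this
  have h2 : u i j * star (u i j) ≤ 1 := by
    rw [← h1]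
    exact Finset.single_le_sum (f := fun k => u i k * star (u i k))
      (fun k _ => mul_star_self_nonneg _) (Finset.mem_univ j)
  have h3 : ‖u i j * star (u i j)‖ ≤ ‖(1 : B)‖ :=
    CStarAlgebra.norm_le_norm_of_nonneg_of_le (mul_star_self_nonneg _) h2
  have h4 : ‖(1 : B)‖ ≤ 1 := by
    rcases subsingleton_or_nontrivial B with hB | hB
    · simp [Subsingleton.elim (1 : B) 0]
    · simp
  rw [CStarRing.norm_self_mul_star] at h3
  nlinarith [norm_nonneg (u i j)]

/-- The relations defining `C(U_N⁺)`. -/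
def unitaryRelations (N : ℕ) : Relations (Fin N × Fin N) where
  Holds _ _ x := IsBiunitary (Matrix.of fun i j => x (i, j))
  bounded := fun ij => ⟨1, fun _ _ _ hx => norm_entry_le_one _ hx.1.2 ij.1 ij.2⟩

/-- The relations defining `C(O_N⁺)`. -/
def orthogonalRelations (N : ℕ) : Relations (Fin N × Fin N) where
  Holds _ _ x := IsOrthogonal (Matrix.of fun i j => x (i, j))
  bounded := fun ij => ⟨1, fun _ _ x hx => by
    refine norm_entry_le_one (Matrix.of fun i j => x (i, j)) ?_ ij.1 ij.2
    have h : (Matrix.of fun i j => x (i, j))ᴴ = (Matrix.of fun i j => x (i, j))ᵀ := by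
      conv_rhs => rw [hx.1]
      rfl
    rw [h]
    exact hx.2.2⟩

/-- The C*-algebra `C(U_N⁺)`. -/
abbrev CUnitary (N : ℕ) : Type 1 := UnivCStar (unitaryRelations N)

/-- The C*-algebra `C(O_N⁺)`. -/
abbrev COrthogonal (N : ℕ) : Type 1 := UnivCStar (orthogonalRelations N)

/-- The fundamental corepresentation of `U_N⁺`. -/
def fundU (N : ℕ) : Matrix (Fin N) (Fin N) (CUnitary N) :=
  Matrix.of fun i j => UnivCStar.gen (unitaryRelations N) (i, j)

/-- The fundamental corepresentation of `O_N⁺`. -/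
def fundO (N : ℕ) : Matrix (Fin N) (Fin N) (COrthogonal N) :=
  Matrix.of fun i j => UnivCStar.gen (orthogonalRelations N) (i, j)

/-! ### Peter-Weyl corepresentations and intertwiners -/

/-- The two colors `∘` and `•`; a colored integer of length `p` is a word `Fin p → Color`. -/
inductive Color
  | white
  | black

/-- `u` for the color `∘`, and `ū` for the color `•`. -/
def coloredFund {n A : Type*} [Star A] (u : Matrix n n A) : Color → Matrix n n A
  | .white => u
  | .black => u.map star

/-- The Peter-Weyl corepresentation `u^{⊗k}`, in the multi-index notation coming from
`(v ⊗ w)_{ia,jb} = v_{ij} w_{ab}`: the entry `(i, j)` is the ordered product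
`(u^{k₁})_{i₁j₁} ⋯ (u^{k_p})_{i_pj_p}`, and `u^{⊗∅} = (1)`. -/
def tensorPow {n A : Type*} [Ring A] [Star A] (u : Matrix n n A) {p : ℕ} (k : Fin p → Color) :
    Matrix (Fin p → n) (Fin p → n) A :=
  Matrix.of fun i j => (List.ofFn fun a => coloredFund u (k a) (i a) (j a)).prod

/-- `Hom(v, w) = {T | T v = w T}`, a space of scalar matrices. -/
def Hom {m n A : Type*} [Fintype m] [Fintype n] [Ring A] [Algebra ℂ A]
    (v : Matrix n n A) (w : Matrix m m A) : Submodule ℂ (Matrix m n ℂ) where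
  carrier := {T | T.map (algebraMap ℂ A) * v = w * T.map (algebraMap ℂ A)}
  add_mem' {S T} hS hT := by
    simp only [Set.mem_ofPred_eq] at hS hT ⊢
    rw [Matrix.map_add _ (map_add _), Matrix.add_mul, Matrix.mul_add, hS, hT]
  zero_mem' := by
    simp only [Set.mem_ofPred_eq]
    rw [Matrix.map_zero _ (map_zero _), Matrix.zero_mul, Matrix.mul_zero]
  smul_mem' c T hT := by
    simp only [Set.mem_ofPred_eq] at hT ⊢
    have h : (c • T).map (algebraMap ℂ A) = c • T.map (algebraMap ℂ A) := by
      ext i j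
      simp [Algebra.smul_def]
    rw [h, Matrix.smul_mul, Matrix.mul_smul, hT]

/-! ### Pairings -/

/-- A pairing between an upper row of `p` points (`Sum.inl`) and a lower row of `q` points (`Sum.inr`),
given by the involution without fixed points exchanging the two ends of each string. -/
structure Pairing (p q : ℕ) where
  partner : Fin p ⊕ Fin q → Fin p ⊕ Fin q
  partner_partner : ∀ a, partner (partner a) = a
  partner_ne : ∀ a, partner a ≠ a

/-- The position of a point when going around the two rows: the upper row from left to right, and then
the lower row from right to left. -/
def position {p q : ℕ} : Fin p ⊕ Fin q → ℕ
  | .inl a => a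
  | .inr b => p + (Fin.rev b : ℕ)

/-- The strings can be drawn between the two rows without crossings: no two strings have ends which
alternate around the boundary. -/
def Pairing.IsNoncrossing {p q : ℕ} (π : Pairing p q) : Prop :=
  ¬ ∃ a b, position a < position b ∧ position b < position (π.partner a) ∧
    position (π.partner a) < position (π.partner b)

/-- Strings with both ends on the same row connect different colors, and strings going from one row to
the other connect equal colors. -/
def Pairing.IsMatching {p q : ℕ} (π : Pairing p q) (k : Fin p → Color) (l : Fin q → Color) : Prop :=
  (∀ a b, π.partner (.inl a) = .inl b → k a ≠ k b) ∧
  (∀ a b, π.partner (.inr a) = .inr b → l a ≠ l b) ∧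
  (∀ a b, π.partner (.inl a) = .inr b → k a = l b)

/-- All the strings of `π` join equal indices, when `i` is put on the upper row and `j` on the lower. -/
def Pairing.Fits {p q : ℕ} {n : Type*} (π : Pairing p q) (i : Fin p → n) (j : Fin q → n) : Prop :=
  ∀ a, Sum.elim i j (π.partner a) = Sum.elim i j a

open scoped Classical in
/-- The matrix of `T_π : (ℂ^N)^{⊗p} → (ℂ^N)^{⊗q}`, `e_i ↦ ∑_j δ_π(i, j) e_j`, in the standard bases. -/
def Pairing.T {p q : ℕ} (π : Pairing p q) (N : ℕ) : Matrix (Fin q → Fin N) (Fin p → Fin N) ℂ :=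
  Matrix.of fun j i => if π.Fits i j then 1 else 0

/-- `NC₂(k, l)`: the noncrossing pairings; they do not depend on the colors of `k` and `l`. -/
def NC2 {p q : ℕ} (_k : Fin p → Color) (_l : Fin q → Color) : Set (Pairing p q) :=
  {π | π.IsNoncrossing}

/-- `𝒩𝒞₂(k, l)`: the noncrossing matching pairings. -/
def MNC2 {p q : ℕ} (k : Fin p → Color) (l : Fin q → Color) : Set (Pairing p q) :=
  {π | π.IsNoncrossing ∧ π.IsMatching k l}

end FreeQG

end

noncomputable section

set_option linter.unusedSectionVars false

namespace FreeQG

/-! ### Words in colored indices -/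

/-! By Frobenius duality, `T` intertwines `u^{⊗k}` and `u^{⊗l}` exactly when `Tᴴ`, read as a vector
on the upper row followed by the conjugated lower row, is fixed by the corresponding tensor power
(`mem_Hom_tensorPow_iff`). So the claim is that the fixed vectors of the tensor powers are spanned
by the noncrossing ones. Both quantum groups are treated at once, over a set of colors with duality:
one self-dual color for `O_N⁺`, two exchanged colors for `U_N⁺`.

That noncrossing vectors are fixed is a computation: inserting a string uses one unitarity relation
(`IsNC.sum_smul_tensorCoeff`).

For the converse it is enough to find one representation of the relations with few fixed vectors,
and it is built from the expected answer. Let `P_m` be the orthogonal projection onto the span of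
noncrossing vectors of length `m`. The expected Haar state sends the coefficient `u_{xy}` to `P_m(x,
y)`; this is `haar`. If it comes from a state on an algebra satisfying the relations, then applying
it to the equation saying that `ξ` is fixed gives `P ξ = ξ`, so `ξ` lies in the span. Only
projections are used, so possible linear dependence of the `T_π` for small `N` plays no role.

Two facts are needed. Compatibility with the relations (`sum_haar_pair_right`, `sum_haar_pair_left`)
holds because the spans are stable under inserting strings and under contracting neighbors; the
latter is the calculus of loops and zigzags in `IsNC.cap`. Positivity (`haar_form_nonneg`) holds
because, on words of bounded length, the spans assemble into a unital matrix *-algebra `C`, and the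
sesquilinear form of the state is `tr(cᴴ Φ(c))`, where `Φ` averages over the projections to `C` of
the matrix units. `Φ` takes values in the commutant of `C`, and this forces the trace to be
nonnegative (`trace_average_nonneg`). The GNS construction then turns `haar` into operators
satisfying the relations, hence into a representation of the universal algebra.

Finally, noncrossing vectors are matched with noncrossing pairings by induction, since a nonempty
noncrossing pairing always has a string joining two neighbors (`IsNCPairing.exists_adjacent`). -/

/-- A set of colors with an involution, `dual c` being the color of the conjugate corepresentation. -/
class Duality (Γ : Type) where
  dual : Γ → Γ
  dual_dual : ∀ c, dual (dual c) = c

/-- The conjugate of a colored index. -/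
def flip {Γ n : Type} [Duality Γ] (a : Γ × n) : Γ × n := (Duality.dual a.1, a.2)

/-- The conjugate of a word: the letters are conjugated and their order is reversed. -/
def conjWord {Γ n : Type} [Duality Γ] (x : List (Γ × n)) : List (Γ × n) := (x.map flip).reverse

section Words

variable {Γ n : Type} [Duality Γ]

@[simp] theorem flip_flip (a : Γ × n) : flip (flip a) = a := by
  simp [flip, Duality.dual_dual]

theorem eq_flip_comm {a b : Γ × n} : a = flip b ↔ b = flip a :=
  ⟨fun h => by rw [h, flip_flip], fun h => by rw [h, flip_flip]⟩

@[simp] theorem conjWord_nil : conjWord ([] : List (Γ × n)) = [] := rfl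

@[simp] theorem conjWord_cons (a : Γ × n) (x : List (Γ × n)) :
    conjWord (a :: x) = conjWord x ++ [flip a] := by
  simp [conjWord]

@[simp] theorem conjWord_append (x y : List (Γ × n)) :
    conjWord (x ++ y) = conjWord y ++ conjWord x := by
  simp [conjWord]

@[simp] theorem conjWord_conjWord (x : List (Γ × n)) : conjWord (conjWord x) = x := by
  simp [conjWord, Function.comp_def]

@[simp] theorem length_conjWord (x : List (Γ × n)) : (conjWord x).length = x.length := by
  simp [conjWord]

end Words

/-- The words of length `m` in a finite alphabet. -/
def words (X : Type) [Fintype X] : ℕ → Finset (List X)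
  | 0 => {[]}
  | m + 1 => (Finset.univ ×ˢ words X m).map
      ⟨fun z => z.1 :: z.2, fun z z' h => by
        obtain ⟨h1, h2⟩ := List.cons.inj h
        exact Prod.ext h1 h2⟩

section WordSums

variable {X : Type} [Fintype X] {M : Type*} [AddCommMonoid M]

theorem sum_words_zero (F : List X → M) : ∑ x ∈ words X 0, F x = F [] := by
  simp [words]

theorem sum_words_succ (m : ℕ) (F : List X → M) :
    ∑ x ∈ words X (m + 1), F x = ∑ a, ∑ x ∈ words X m, F (a :: x) := by
  simp only [words, Finset.sum_map, Finset.sum_product]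
  rfl

theorem mem_words {m : ℕ} {x : List X} : x ∈ words X m ↔ x.length = m := by
  induction m generalizing x with
  | zero => simp [words]
  | succ m ih =>
    cases x with
    | nil => simp [words]
    | cons a x =>
      simp only [words, Finset.mem_map, Finset.mem_product, Finset.mem_univ, true_and, ih,
        Prod.exists, List.length_cons, Nat.add_right_cancel_iff]
      constructor
      · rintro ⟨b, y, hy, h⟩
        obtain ⟨-, rfl⟩ := List.cons.inj h
        exact hy
      · exact fun h => ⟨a, x, h, rfl⟩

theorem sum_words_add (l m : ℕ) (F : List X → M) :
    ∑ x ∈ words X (l + m), F x = ∑ x ∈ words X l, ∑ y ∈ words X m, F (x ++ y) := by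
  induction l generalizing F with
  | zero => simp [sum_words_zero]
  | succ l ih =>
    rw [show l + 1 + m = (l + m) + 1 by omega, sum_words_succ, sum_words_succ]
    exact Finset.sum_congr rfl fun a _ => by rw [ih]; rfl

end WordSums

section WordSumsConj

variable {Γ n : Type} [Duality Γ] [Fintype Γ] [Fintype n] {M : Type*} [AddCommMonoid M]

theorem sum_words_conj (m : ℕ) (F : List (Γ × n) → M) :
    ∑ x ∈ words (Γ × n) m, F (conjWord x) = ∑ x ∈ words (Γ × n) m, F x := by
  refine Finset.sum_nbij' conjWord conjWord ?_ ?_ ?_ ?_ ?_ <;> simp [mem_words]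

theorem sum_words_succ' (m : ℕ) (F : List (Γ × n) → M) :
    ∑ x ∈ words (Γ × n) (m + 1), F x = ∑ x ∈ words (Γ × n) m, ∑ a, F (x ++ [a]) := by
  rw [sum_words_add]
  exact Finset.sum_congr rfl fun x _ => by
    rw [show (1 : ℕ) = 0 + 1 from rfl, sum_words_succ]
    simp [sum_words_zero]

end WordSumsConj

/-! ### Cups and caps -/

section CupCap

variable {Γ n : Type} [Duality Γ] [DecidableEq Γ] [DecidableEq n]

/-- Insertion of a string of color `c` at the positions `p`, `p + 1`. -/
def cup (p : ℕ) (c : Γ) : (List (Γ × n) → ℂ) →ₗ[ℂ] (List (Γ × n) → ℂ) where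
  toFun f x := match x.drop p with
    | s :: t :: b => if s.1 = c ∧ t = flip s then f (x.take p ++ b) else 0
    | _ => 0
  map_add' f g := by
    ext x
    simp only [Pi.add_apply]
    split
    · split_ifs <;> simp
    · simp
  map_smul' r f := by
    ext x
    simp only [Pi.smul_apply, RingHom.id_apply]
    split
    · split_ifs <;> simp
    · simp

theorem cup_append {p : ℕ} {a : List (Γ × n)} (ha : a.length = p) (c : Γ) (f : List (Γ × n) → ℂ)
    (s t : Γ × n) (b : List (Γ × n)) :
    cup p c f (a ++ s :: t :: b) = if s.1 = c ∧ t = flip s then f (a ++ b) else 0 := by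
  subst ha
  simp [cup]

theorem cup_of_length_lt {p : ℕ} (c : Γ) (f : List (Γ × n) → ℂ) {x : List (Γ × n)}
    (hx : x.length < p + 2) : cup p c f x = 0 := by
  have h : (x.drop p).length < 2 := by simp; omega
  simp only [cup, LinearMap.coe_mk, AddHom.coe_mk]
  split
  · rename_i h'
    rw [h'] at h
    simp at h
  · rfl

variable [Fintype n]

/-- Contraction of the positions `p`, `p + 1` along a string of color `c`. -/
def cap (p : ℕ) (c : Γ) : (List (Γ × n) → ℂ) →ₗ[ℂ] (List (Γ × n) → ℂ) where
  toFun f y := ∑ i, f (y.take p ++ (c, i) :: (Duality.dual c, i) :: y.drop p)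
  map_add' f g := by
    ext x
    simp [Finset.sum_add_distrib]
  map_smul' r f := by
    ext x
    simp [Finset.mul_sum]

theorem cap_append {p : ℕ} {a : List (Γ × n)} (ha : a.length = p) (c : Γ) (f : List (Γ × n) → ℂ)
    (b : List (Γ × n)) :
    cap p c f (a ++ b) = ∑ i, f (a ++ (c, i) :: (Duality.dual c, i) :: b) := by
  subst ha
  simp [cap]

end CupCap

/-! ### Functions on words of a given length, and noncrossing vectors -/

/-- `f` vanishes outside the words of length `m`. -/
def SupportedOn {X : Type} (m : ℕ) (f : List X → ℂ) : Prop := ∀ x, x.length ≠ m → f x = 0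

/-- Tensors are functions on lists of every length, so that concatenation needs no casts; the
support condition then recovers equality from the single relevant length. -/
theorem SupportedOn.ext {X : Type} {m : ℕ} {f g : List X → ℂ} (hf : SupportedOn m f)
    (hg : SupportedOn m g) (h : ∀ x, x.length = m → f x = g x) : f = g := by
  ext x
  by_cases hx : x.length = m
  · exact h x hx
  · rw [hf x hx, hg x hx]

theorem exists_append {X : Type} {x : List X} {p q : ℕ} (h : x.length = p + q) :
    ∃ a b, x = a ++ b ∧ a.length = p ∧ b.length = q :=
  ⟨x.take p, x.drop p, by simp, by simp; omega, by simp; omega⟩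

theorem exists_append_two {X : Type} {x : List X} {p q : ℕ} (h : x.length = p + q + 2) :
    ∃ a s t b, x = a ++ s :: t :: b ∧ a.length = p ∧ b.length = q := by
  obtain ⟨a, b, rfl, ha, hb⟩ := exists_append (x := x) (p := p) (q := q + 2) (by omega)
  match b, hb with
  | s :: t :: b, hb => exact ⟨a, s, t, b, rfl, ha, by simpa using hb⟩

section NC

variable {Γ n : Type} [Duality Γ] [DecidableEq Γ] [DecidableEq n]

/-- The vectors obtained from `1` by successive insertions of strings; the first argument is the color
word of the tensor power in which the vector lives. -/
inductive IsNC : List Γ → (List (Γ × n) → ℂ) → Prop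
  | nil : IsNC [] (fun x => if x = [] then 1 else 0)
  | cup (a b : List Γ) (c : Γ) (f : List (Γ × n) → ℂ) (h : IsNC (a ++ b) f) :
      IsNC (a ++ c :: Duality.dual c :: b) (cup a.length c f)

theorem cup_ne_zero {p : ℕ} {c : Γ} {f : List (Γ × n) → ℂ} {x : List (Γ × n)}
    (h : cup p c f x ≠ 0) :
    ∃ a s b, x = a ++ s :: flip s :: b ∧ a.length = p ∧ s.1 = c ∧ f (a ++ b) ≠ 0 := by
  by_cases hx : x.length < p + 2
  · exact absurd (cup_of_length_lt c f hx) h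
  · obtain ⟨a, s, t, b, rfl, ha, -⟩ :=
      exists_append_two (x := x) (p := p) (q := x.length - p - 2) (by omega)
    rw [cup_append ha] at h
    split_ifs at h with h'
    · obtain ⟨h1, rfl⟩ := h'
      exact ⟨a, s, b, rfl, ha, h1, h⟩
    · exact absurd rfl h

/-- Each insertion prescribes the colors of both new letters, so a noncrossing vector lives on a
single color word. This allows `fixSpace` to mix all color words of one length and still be
separated afterwards. -/
theorem IsNC.color {w : List Γ} {f : List (Γ × n) → ℂ} (h : IsNC w f) {x : List (Γ × n)}
    (hx : f x ≠ 0) : x.map Prod.fst = w := by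
  induction h generalizing x with
  | nil =>
    have : x = [] := by
      by_contra h
      simp [h] at hx
    simp [this]
  | cup a b c f h ih =>
    obtain ⟨a', s, b', rfl, ha, rfl, hf⟩ := cup_ne_zero hx
    have := ih hf
    rw [List.map_append] at this
    obtain ⟨h1, h2⟩ := List.append_inj this (by simpa using ha)
    simp [h1, h2, flip]

theorem IsNC.supportedOn {w : List Γ} {f : List (Γ × n) → ℂ} (h : IsNC w f) :
    SupportedOn w.length f := by
  intro x hx
  by_contra hf
  exact hx (by rw [← h.color hf]; simp)

theorem SupportedOn.cup {m p : ℕ} {f : List (Γ × n) → ℂ} (hf : SupportedOn m f) (c : Γ) :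
    SupportedOn (m + 2) (cup p c f) := by
  intro x hx
  by_contra h
  obtain ⟨a, s, b, rfl, -, -, h⟩ := cup_ne_zero h
  apply h
  apply hf
  simp at hx ⊢
  omega

theorem SupportedOn.cap [Fintype n] {m p : ℕ} {f : List (Γ × n) → ℂ} (hf : SupportedOn (m + 2) f)
    (c : Γ) : SupportedOn m (cap p c f) := by
  intro x hx
  refine Finset.sum_eq_zero fun i _ => hf _ ?_
  simp
  omega

/-- The fixed vectors of length `m`: the span of the noncrossing vectors. -/
def fixSpace (Γ n : Type) [Duality Γ] [DecidableEq Γ] [DecidableEq n] (m : ℕ) :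
    Submodule ℂ (List (Γ × n) → ℂ) :=
  Submodule.span ℂ {f | ∃ w : List Γ, w.length = m ∧ IsNC w f}

theorem supportedOn_of_mem_fixSpace {m : ℕ} {f : List (Γ × n) → ℂ} (hf : f ∈ fixSpace Γ n m) :
    SupportedOn m f := by
  induction hf using Submodule.span_induction with
  | mem f hf =>
    obtain ⟨w, rfl, hf⟩ := hf
    exact hf.supportedOn
  | zero => exact fun x _ => rfl
  | add f g _ _ hf hg => exact fun x hx => by simp [hf x hx, hg x hx]
  | smul r f _ hf => exact fun x hx => by simp [hf x hx]

theorem nil_mem_fixSpace :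
    (fun x => if x = [] then 1 else 0 : List (Γ × n) → ℂ) ∈ fixSpace Γ n 0 :=
  Submodule.subset_span ⟨[], rfl, IsNC.nil⟩

theorem cup_mem_fixSpace {m p : ℕ} (hp : p ≤ m) (c : Γ) {f : List (Γ × n) → ℂ}
    (hf : f ∈ fixSpace Γ n m) : cup p c f ∈ fixSpace Γ n (m + 2) := by
  induction hf using Submodule.span_induction with
  | mem f hf =>
    obtain ⟨w, rfl, hf⟩ := hf
    obtain ⟨a, b, rfl, rfl, -⟩ := exists_append (x := w) (p := p) (q := w.length - p) (by omega)
    exact Submodule.subset_span ⟨_, by simp; omega, IsNC.cup a b c f hf⟩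
  | zero => simp
  | add f g _ _ hf hg => rw [map_add]; exact add_mem hf hg
  | smul r f _ hf => rw [map_smul]; exact Submodule.smul_mem _ _ hf

variable [Fintype n]

/-- Closing a string on itself produces a loop, whose value is the dimension. -/
theorem cap_cup_self {m p : ℕ} (hp : p ≤ m) (c : Γ) {f : List (Γ × n) → ℂ} (hf : SupportedOn m f) :
    cap p c (cup p c f) = (Fintype.card n : ℂ) • f := by
  refine SupportedOn.ext ((hf.cup c).cap _) (fun x hx => by simp [hf x hx]) fun x hx => ?_
  obtain ⟨a, b, rfl, ha, -⟩ := exists_append (x := x) (p := p) (q := m - p) (by omega)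
  rw [cap_append ha]
  simp [cup_append ha, flip]

/-- Zigzag identity: a cup followed by a cap shifted by one straightens to the identity. In general
this composition keeps only words whose letter at that place has color `c`, hence the assumption on
the color word of `f`. The mirror image is `cap_cup_succ`. -/
theorem cap_succ_cup {a b : List Γ} {c : Γ} {f : List (Γ × n) → ℂ} (hf : IsNC (a ++ c :: b) f) :
    cap (a.length + 1) (Duality.dual c) (cup a.length c f) = f := by
  refine SupportedOn.ext ((hf.supportedOn.cup c).cap _) hf.supportedOn fun x hx => ?_
  obtain ⟨y, z, rfl, hy, hz⟩ := exists_append (x := x) (p := a.length) (q := b.length + 1)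
    (by simpa using hx)
  match z, hz with
  | t :: z, hz =>
    rw [show y ++ t :: z = (y ++ [t]) ++ z by simp, cap_append (by simp [hy])]
    have : ∀ i, cup a.length c f (y ++ [t] ++ (Duality.dual c, i) ::
        (Duality.dual (Duality.dual c), i) :: z) =
        if t = (c, i) then f (y ++ [t] ++ z) else 0 := by
      intro i
      rw [List.append_assoc, List.singleton_append, cup_append hy]
      by_cases h : t = (c, i)
      · subst h
        simp [flip, Duality.dual_dual]
      · rw [if_neg h, if_neg]
        rintro ⟨h1, h2⟩
        rw [eq_flip_comm] at h2
        exact h (by rw [h2]; simp [flip, Duality.dual_dual])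
    simp only [this]
    by_cases h : t.1 = c
    · subst h
      simp [Prod.ext_iff]
    · rw [Finset.sum_eq_zero]
      · by_contra h'
        have := hf.color (Ne.symm h')
        simp only [List.map_append, List.append_assoc] at this
        have := (List.append_inj this (by simpa using hy)).2
        simp at this
        exact h this.1
      · rintro i -
        rw [if_neg]
        rintro rfl
        exact h rfl

theorem cap_cup_succ {a b : List Γ} {c : Γ} {f : List (Γ × n) → ℂ} (hf : IsNC (a ++ c :: b) f) :
    cap a.length c (cup (a.length + 1) (Duality.dual c) f) = f := by
  refine SupportedOn.ext ((hf.supportedOn.cup _).cap _) hf.supportedOn fun x hx => ?_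
  obtain ⟨y, z, rfl, hy, hz⟩ := exists_append (x := x) (p := a.length) (q := b.length + 1)
    (by simpa using hx)
  match z, hz with
  | t :: z, hz =>
    rw [cap_append hy]
    have : ∀ i, cup (a.length + 1) (Duality.dual c) f (y ++ (c, i) ::
        (Duality.dual c, i) :: t :: z) = if t = (c, i) then f (y ++ t :: z) else 0 := by
      intro i
      rw [show y ++ (c, i) :: (Duality.dual c, i) :: t :: z =
        (y ++ [(c, i)]) ++ (Duality.dual c, i) :: t :: z by simp, cup_append (by simp [hy])]
      by_cases h : t = (c, i)
      · subst h
        simp [flip, Duality.dual_dual]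
      · rw [if_neg h, if_neg]
        rintro ⟨h1, h2⟩
        exact h (by rw [h2]; simp [flip, Duality.dual_dual])
    simp only [this]
    by_cases h : t.1 = c
    · subst h
      simp [Prod.ext_iff]
    · rw [Finset.sum_eq_zero]
      · by_contra h'
        have := hf.color (Ne.symm h')
        rw [List.map_append] at this
        have := (List.append_inj this (by simpa using hy)).2
        simp at this
        exact h this.1
      · rintro i -
        rw [if_neg]
        rintro rfl
        exact h rfl

/-- Operations at disjoint places commute; the shift by 2 accounts for the two letters inserted on
the left. -/
theorem cap_cup_right {p q r : ℕ} (c d : Γ) {f : List (Γ × n) → ℂ}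
    (hf : SupportedOn (p + q + r + 2) f) :
    cap (p + q + 2) c (cup p d f) = cup p d (cap (p + q) c f) := by
  refine SupportedOn.ext (m := p + q + r + 2) ((hf.cup d).cap _) (hf.cap (p := p + q) c |>.cup d)
    fun x hx => ?_
  obtain ⟨a, s, t, b, rfl, ha, hb⟩ := exists_append_two (x := x) (p := p) (q := q + r) (by omega)
  obtain ⟨b, e, rfl, hb, -⟩ := exists_append hb
  rw [cup_append ha, show a ++ s :: t :: (b ++ e) = (a ++ s :: t :: b) ++ e by simp,
    cap_append (by simp; omega)]
  simp only [List.append_assoc, List.cons_append, cup_append ha]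
  split_ifs
  · rw [← List.append_assoc, cap_append (by simp; omega)]
    simp
  · simp

theorem cap_cup_left {p q r : ℕ} (c d : Γ) {f : List (Γ × n) → ℂ}
    (hf : SupportedOn (p + q + r + 2) f) :
    cap p c (cup (p + q + 2) d f) = cup (p + q) d (cap p c f) := by
  refine SupportedOn.ext (m := p + q + r + 2) ((hf.cup d).cap _) (hf.cap (p := p) c |>.cup d)
    fun x hx => ?_
  obtain ⟨a, s, t, b, rfl, ha, hb⟩ :=
    exists_append_two (x := x) (p := p + q) (q := r) (by omega)
  rw [cup_append ha]
  obtain ⟨a, e, rfl, ha', he⟩ := exists_append ha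
  rw [List.append_assoc, cap_append ha']
  have : ∀ i, a ++ (c, i) :: (Duality.dual c, i) :: (e ++ s :: t :: b) =
    (a ++ (c, i) :: (Duality.dual c, i) :: e) ++ s :: t :: b := by simp
  simp only [this]
  rw [Finset.sum_congr rfl fun i _ => cup_append (by simp; omega) _ _ _ _ _]
  split_ifs
  · rw [List.append_assoc, cap_append ha']
    simp
  · simp

/-- The span of the noncrossing vectors with a given color word. -/
def fixSpaceOf (n : Type) [DecidableEq n] (w : List Γ) : Submodule ℂ (List (Γ × n) → ℂ) :=
  Submodule.span ℂ {f | IsNC w f}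

theorem cup_mem_fixSpaceOf (a b : List Γ) (c : Γ) {f : List (Γ × n) → ℂ}
    (hf : f ∈ fixSpaceOf n (a ++ b)) :
    cup a.length c f ∈ fixSpaceOf n (a ++ c :: Duality.dual c :: b) := by
  induction hf using Submodule.span_induction with
  | mem f hf => exact Submodule.subset_span (IsNC.cup a b c f hf)
  | zero => simp
  | add f g _ _ hf hg => rw [map_add]; exact add_mem hf hg
  | smul r f _ hf => rw [map_smul]; exact Submodule.smul_mem _ _ hf

/-- The relative positions of two adjacent pairs in one word: equal, overlapping in one letter on
either side, or disjoint on either side. -/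
theorem two_pairs_cases {X : Type} {a b a' b' : List X} {s t s' t' : X}
    (h : a' ++ s' :: t' :: b' = a ++ s :: t :: b) :
    (a = a' ∧ s = s' ∧ t = t' ∧ b = b') ∨ (a = a' ++ [s'] ∧ s = t' ∧ b' = t :: b) ∨
    (a' = a ++ [s] ∧ t = s' ∧ b = t' :: b') ∨
    (∃ e, a = a' ++ s' :: t' :: e ∧ b' = e ++ s :: t :: b) ∨
    (∃ e, a' = a ++ s :: t :: e ∧ b = e ++ s' :: t' :: b') := by
  rcases List.append_eq_append_iff.1 h with ⟨e, rfl, h2⟩ | ⟨e, rfl, h2⟩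
  · match e, h2 with
    | [], h2 => simp at h2; grind
    | [u], h2 => simp at h2; grind
    | u :: v :: e, h2 => simp at h2; grind
  · match e, h2 with
    | [], h2 => simp at h2; grind
    | [u], h2 => simp at h2; grind
    | u :: v :: e, h2 => simp at h2; grind

/-- Compare the contracted pair with the last inserted string. The same place gives a loop, an
overlap gives a zigzag, and disjoint places commute, so that the induction hypothesis applies below
the insertion. -/
theorem IsNC.cap {w : List Γ} {f : List (Γ × n) → ℂ} (hf : IsNC w f) {a b : List Γ} {c : Γ}
    (hw : w = a ++ c :: Duality.dual c :: b) : cap a.length c f ∈ fixSpaceOf n (a ++ b) := by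
  induction hf generalizing a b c with
  | nil => simp at hw
  | cup a' b' c' f hf ih =>
    rcases two_pairs_cases hw with ⟨rfl, rfl, -, rfl⟩ | ⟨rfl, rfl, rfl⟩ | ⟨rfl, rfl, rfl⟩ |
      ⟨e, rfl, rfl⟩ | ⟨e, rfl, rfl⟩
    · rw [cap_cup_self (m := (a ++ b).length) (by simp) c hf.supportedOn]
      exact Submodule.smul_mem _ _ (Submodule.subset_span hf)
    · simp only [Duality.dual_dual] at hf ⊢
      simp only [List.length_append, List.length_singleton]
      rw [cap_succ_cup hf]
      exact Submodule.subset_span (by simpa using hf)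
    · simp only [Duality.dual_dual, List.append_assoc, List.singleton_append,
        List.length_append, List.length_singleton] at hf ⊢
      rw [cap_cup_succ hf]
      exact Submodule.subset_span hf
    · have := ih (a := a' ++ e) (b := b) (c := c) (by simp)
      rw [List.append_assoc] at this
      have := cup_mem_fixSpaceOf _ _ c' this
      simp only [List.length_append, List.length_cons, List.append_assoc, List.cons_append]
        at this ⊢
      rwa [show a'.length + (e.length + 1 + 1) = a'.length + e.length + 2 by omega,
        cap_cup_right (r := b.length)]
      simpa [add_assoc] using hf.supportedOn
    · have := ih (a := a) (b := e ++ b') (c := c) (by simp)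
      rw [← List.append_assoc] at this
      have := cup_mem_fixSpaceOf _ _ c' this
      simp only [List.length_append, List.length_cons, List.append_assoc]
        at this ⊢
      rwa [show a.length + (e.length + 1 + 1) = a.length + e.length + 2 by omega,
        cap_cup_left (r := b'.length)]
      have := hf.supportedOn
      simp only [List.length_append, List.length_cons] at this
      convert this using 1
      omega

theorem fixSpaceOf_le (w : List Γ) : fixSpaceOf n w ≤ fixSpace Γ n w.length :=
  Submodule.span_mono fun _ hf => ⟨w, rfl, hf⟩

/-- If the two contracted letters have the colors `c`, `dual c`, this is `IsNC.cap`; for any other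
colors the contraction vanishes. -/
theorem cap_mem_fixSpace {m p : ℕ} (hp : p ≤ m) (c : Γ) {f : List (Γ × n) → ℂ}
    (hf : f ∈ fixSpace Γ n (m + 2)) : cap p c f ∈ fixSpace Γ n m := by
  induction hf using Submodule.span_induction with
  | mem f hf =>
    obtain ⟨w, hw, hf⟩ := hf
    obtain ⟨a, s, t, b, rfl, ha, hb⟩ := exists_append_two (x := w) (p := p) (q := m - p) (by omega)
    by_cases h : s = c ∧ t = Duality.dual c
    · obtain ⟨rfl, rfl⟩ := h
      have := fixSpaceOf_le _ (hf.cap rfl)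
      rwa [ha, show (a ++ b).length = m by simp; omega] at this
    · have : cap p c f = 0 := by
        refine SupportedOn.ext (m := m) ((hw ▸ hf.supportedOn).cap c) (fun _ _ => rfl) fun x hx => ?_
        obtain ⟨y, z, rfl, hy, -⟩ := exists_append (x := x) (p := p) (q := m - p) (by omega)
        rw [cap_append hy]
        refine Finset.sum_eq_zero fun i _ => ?_
        by_contra h'
        have := hf.color h'
        rw [List.map_append] at this
        have := (List.append_inj this (by simp [ha, hy])).2
        simp at this
        exact h ⟨this.1.symm, this.2.1.symm⟩
      rw [this]
      exact zero_mem _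
  | zero => simp
  | add f g _ _ hf hg => rw [map_add]; exact add_mem hf hg
  | smul r f _ hf => rw [map_smul]; exact Submodule.smul_mem _ _ hf

end NC

/-! ### Stability of the noncrossing spans, and the projections onto them -/

section FixSpace

variable {Γ n : Type} [Duality Γ] [DecidableEq Γ] [DecidableEq n]

open scoped ComplexConjugate

/-- Reflecting a diagram moves a string with `p` points to its left to one with `q` points to its
left. Its color is unchanged: order and colors are both reversed, and the dual of `dual c` is `c`.
-/
theorem conj_cup {p q : ℕ} (c : Γ) {f g : List (Γ × n) → ℂ}
    (h : ∀ x, x.length = p + q → g x = conj (f (conjWord x))) {x : List (Γ × n)}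
    (hx : x.length = p + q + 2) : cup q c g x = conj (cup p c f (conjWord x)) := by
  obtain ⟨a, s, t, b, rfl, ha, hb⟩ := exists_append_two (x := x) (p := q) (q := p) (by omega)
  rw [cup_append ha, h _ (by simp; omega)]
  simp only [conjWord_append, conjWord_cons, List.append_assoc, List.cons_append, List.nil_append]
  rw [cup_append (by simp [hb])]
  have : s.1 = c ∧ t = flip s ↔ (flip t).1 = c ∧ flip s = flip (flip t) := by
    constructor
    · rintro ⟨rfl, rfl⟩
      simp
    · rintro ⟨rfl, h⟩
      rw [flip_flip] at h
      simp [← h]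
  by_cases hc : s.1 = c ∧ t = flip s
  · rw [if_pos hc, if_pos (this.1 hc)]
  · rw [if_neg hc, if_neg (fun h => hc (this.2 h)), map_zero]

theorem exists_conj_mem_fixSpace {m : ℕ} {f : List (Γ × n) → ℂ} (hf : f ∈ fixSpace Γ n m) :
    ∃ g ∈ fixSpace Γ n m, ∀ x, x.length = m → g x = conj (f (conjWord x)) := by
  induction hf using Submodule.span_induction with
  | mem f hf =>
    obtain ⟨w, rfl, hf⟩ := hf
    induction hf with
    | nil => exact ⟨_, nil_mem_fixSpace, fun x hx => by simp [List.length_eq_zero_iff.1 hx]⟩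
    | cup a b c f hf ih =>
      obtain ⟨g, hg, h⟩ := ih
      have hl : (a ++ c :: Duality.dual c :: b).length = (a ++ b).length + 2 := by simp; omega
      rw [hl]
      refine ⟨_, cup_mem_fixSpace (p := b.length) (by simp) c hg, fun x hx => ?_⟩
      exact conj_cup c (fun x hx => h x (by simpa using hx)) (by simpa using hx)
  | zero => exact ⟨0, zero_mem _, by simp⟩
  | add f f' _ _ hf hf' =>
    obtain ⟨g, hg, h⟩ := hf
    obtain ⟨g', hg', h'⟩ := hf'
    exact ⟨g + g', add_mem hg hg', fun x hx => by simp [h x hx, h' x hx]⟩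
  | smul r f _ hf =>
    obtain ⟨g, hg, h⟩ := hf
    exact ⟨conj r • g, Submodule.smul_mem _ _ hg, fun x hx => by simp [h x hx]⟩

/-- Juxtaposition of diagrams: the insertions which build `f` from `1` are performed on `g` instead,
to the left of its letters. -/
theorem exists_tensor_mem_fixSpace {l m : ℕ} {f g : List (Γ × n) → ℂ} (hf : f ∈ fixSpace Γ n l)
    (hg : g ∈ fixSpace Γ n m) :
    ∃ h ∈ fixSpace Γ n (l + m), ∀ x y, x.length = l → h (x ++ y) = f x * g y := by
  induction hf using Submodule.span_induction with
  | mem f hf =>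
    obtain ⟨w, rfl, hf⟩ := hf
    induction hf with
    | nil => exact ⟨g, by simpa using hg, fun x y hx => by simp [List.length_eq_zero_iff.1 hx]⟩
    | cup a b c f hf ih =>
      obtain ⟨h, hh, e⟩ := ih
      have hl : (a ++ c :: Duality.dual c :: b).length + m = ((a ++ b).length + m) + 2 := by
        simp; omega
      rw [hl]
      refine ⟨_, cup_mem_fixSpace (p := a.length) (by simp; omega) c hh, fun x y hx => ?_⟩
      obtain ⟨x, s, t, x', rfl, hx1, hx2⟩ :=
        exists_append_two (x := x) (p := a.length) (q := b.length) (by simp at hx; omega)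
      simp only [List.append_assoc, List.cons_append]
      rw [cup_append hx1, cup_append hx1, ← List.append_assoc, e _ _ (by simp [hx1, hx2])]
      split_ifs <;> simp
  | zero => exact ⟨0, zero_mem _, by simp⟩
  | add f f' _ _ hf hf' =>
    obtain ⟨h, hh, e⟩ := hf
    obtain ⟨h', hh', e'⟩ := hf'
    exact ⟨h + h', add_mem hh hh', fun x y hx => by simp [e x y hx, e' x y hx, add_mul]⟩
  | smul r f _ hf =>
    obtain ⟨h, hh, e⟩ := hf
    exact ⟨r • h, Submodule.smul_mem _ _ hh, fun x y hx => by simp [e x y hx, mul_assoc]⟩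

variable [Fintype Γ] [Fintype n]

/-- Nested caps, the innermost one first. Summing over the color of each cap turns a sum over
indices into a sum over letters. -/
theorem exists_contract_mem_fixSpace {l q : ℕ} (r : ℕ) {f : List (Γ × n) → ℂ}
    (hf : f ∈ fixSpace Γ n (l + q + 2 * r)) :
    ∃ g ∈ fixSpace Γ n (l + q), ∀ x y, x.length = l → y.length = q →
      g (x ++ y) = ∑ z ∈ words (Γ × n) r, f (x ++ z ++ conjWord z ++ y) := by
  induction r generalizing f with
  | zero => exact ⟨f, hf, fun x y _ _ => by simp [sum_words_zero]⟩
  | succ r ih =>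
    obtain ⟨g, hg, h⟩ := ih (f := ∑ c, cap (l + r) c f)
      (sum_mem fun c _ => cap_mem_fixSpace (by omega) c hf)
    refine ⟨g, hg, fun x y hx hy => ?_⟩
    rw [h x y hx hy, sum_words_succ']
    refine Finset.sum_congr rfl fun z hz => ?_
    rw [mem_words] at hz
    rw [Finset.sum_apply, Fintype.sum_prod_type]
    refine Finset.sum_congr rfl fun c _ => ?_
    rw [List.append_assoc, cap_append (by simp [hx, hz])]
    refine Finset.sum_congr rfl fun i _ => ?_
    simp [flip]

/-- Composition of the intertwiners given by fixed vectors. -/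
theorem exists_comp_mem_fixSpace {l r q : ℕ} {f g : List (Γ × n) → ℂ}
    (hf : f ∈ fixSpace Γ n (l + r)) (hg : g ∈ fixSpace Γ n (r + q)) :
    ∃ h ∈ fixSpace Γ n (l + q), ∀ x y, x.length = l → y.length = q →
      h (x ++ y) = ∑ z ∈ words (Γ × n) r, f (x ++ z) * g (conjWord z ++ y) := by
  obtain ⟨k, hk, e⟩ := exists_tensor_mem_fixSpace hf hg
  obtain ⟨h, hh, e'⟩ := exists_contract_mem_fixSpace (l := l) (q := q) r (f := k)
    (by convert hk using 2; omega)
  refine ⟨h, hh, fun x y hx hy => ?_⟩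
  rw [e' x y hx hy]
  refine Finset.sum_congr rfl fun z hz => ?_
  rw [mem_words] at hz
  rw [List.append_assoc, e _ _ (by simp [hx, hz])]

/-- The identity, bent into a vector, is a nest of `r` cups summed over all colors; each step
inserts the innermost string. -/
theorem exists_id_mem_fixSpace (r : ℕ) :
    ∃ f ∈ fixSpace Γ n (r + r), ∀ x y, x.length = r → y.length = r →
      f (conjWord x ++ y) = if x = y then 1 else 0 := by
  induction r with
  | zero =>
    refine ⟨_, nil_mem_fixSpace, fun x y hx hy => ?_⟩
    simp [List.length_eq_zero_iff.1 hx, List.length_eq_zero_iff.1 hy]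
  | succ r ih =>
    obtain ⟨f, hf, h⟩ := ih
    refine ⟨∑ c, cup r c f, sum_mem fun c _ => ?_, fun x y hx hy => ?_⟩
    · convert cup_mem_fixSpace (p := r) (by omega) c hf using 2
      omega
    · match x, y, hx, hy with
      | a :: x, b :: y, hx, hy =>
        simp only [List.length_cons, Nat.add_right_cancel_iff] at hx hy
        rw [Finset.sum_apply]
        simp only [conjWord_cons, List.append_assoc, List.singleton_append]
        rw [Finset.sum_congr rfl fun c _ => cup_append (by simp [hx]) _ _ _ _ _]
        rw [Finset.sum_eq_single (flip a).1]
        · rw [h x y hx hy]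
          simp only [flip_flip, true_and, List.cons.injEq]
          by_cases hab : a = b
          · simp [hab]
          · rw [if_neg (fun h => hab h.symm), if_neg (fun h => hab h.1)]
        · intro c _ hc
          rw [if_neg]
          exact fun h => hc h.1.symm
        · simp

/-! ### The orthogonal projection onto the fixed vectors -/

/-- A function on the words of length `m`, extended by zero. -/
def extendWords (X : Type) [Fintype X] (m : ℕ) :
    EuclideanSpace ℂ (words X m) →ₗ[ℂ] (List X → ℂ) where
  toFun v x := if h : x.length = m then v ⟨x, mem_words.2 h⟩ else 0
  map_add' v w := by
    ext x
    by_cases h : x.length = m <;> simp [h]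
  map_smul' r v := by
    ext x
    by_cases h : x.length = m <;> simp [h]

/-- The restriction to the words of length `m`. -/
def restrictWords (X : Type) [Fintype X] (m : ℕ) :
    (List X → ℂ) →ₗ[ℂ] EuclideanSpace ℂ (words X m) where
  toFun f := WithLp.toLp 2 fun x => f x
  map_add' _ _ := rfl
  map_smul' _ _ := rfl

theorem extendWords_apply {X : Type} [Fintype X] {m : ℕ} (v : EuclideanSpace ℂ (words X m))
    {x : List X} (h : x.length = m) : extendWords X m v x = v ⟨x, mem_words.2 h⟩ :=
  dif_pos h

theorem extendWords_of_length_ne {X : Type} [Fintype X] {m : ℕ}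
    (v : EuclideanSpace ℂ (words X m)) {x : List X} (h : x.length ≠ m) : extendWords X m v x = 0 :=
  dif_neg h

theorem restrictWords_apply {X : Type} [Fintype X] {m : ℕ} (f : List X → ℂ) (x : words X m) :
    restrictWords X m f x = f x := rfl

theorem extendWords_restrictWords {X : Type} [Fintype X] {m : ℕ} {f : List X → ℂ}
    (hf : SupportedOn m f) : extendWords X m (restrictWords X m f) = f := by
  ext x
  by_cases h : x.length = m
  · rw [extendWords_apply _ h, restrictWords_apply]
  · rw [extendWords_of_length_ne _ h, hf x h]

/-- Orthogonal projection needs a Hilbert space, so functions are restricted to the finitely many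
words of length `m`, projected there, and extended by zero. -/
theorem exists_projection_kernel (X : Type) [Fintype X] [DecidableEq X] (m : ℕ)
    (V : Submodule ℂ (List X → ℂ)) (hV : ∀ f ∈ V, SupportedOn m f) :
    ∃ P : List X → List X → ℂ, (∀ y, (fun x => P x y) ∈ V) ∧
      (∀ f ∈ V, ∀ x, ∑ y ∈ words X m, P x y * f y = f x) ∧ ∀ x y, conj (P x y) = P y x := by
  set F := V.map (restrictWords X m)
  have hF : ∀ v ∈ F, extendWords X m v ∈ V := by
    rintro _ ⟨f, hf, rfl⟩
    rwa [extendWords_restrictWords (hV f hf)]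
  refine ⟨fun x y => extendWords X m (F.starProjection (restrictWords X m (Pi.single y 1))) x,
    fun y => hF _ (F.starProjection_apply_mem _), fun f hf x => ?_, fun x y => ?_⟩
  · have h1 : ∑ y ∈ words X m, f y • restrictWords X m (Pi.single y 1) = restrictWords X m f := by
      simp only [← map_smul, ← map_sum]
      ext z
      simp only [restrictWords_apply, Finset.sum_apply, Pi.smul_apply, smul_eq_mul]
      rw [Finset.sum_eq_single z.1]
      · simp
      · intro y _ hy
        simp [hy.symm]
      · exact fun h => absurd z.2 h
    have h2 : F.starProjection (restrictWords X m f) = restrictWords X m f :=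
      F.starProjection_eq_self_iff.2 ⟨f, hf, rfl⟩
    have h3 := congrArg (fun v => extendWords X m (F.starProjection v) x) h1
    simp only [h2, extendWords_restrictWords (hV f hf), map_sum, map_smul, Finset.sum_apply,
      Pi.smul_apply, smul_eq_mul] at h3
    rw [← h3]
    exact Finset.sum_congr rfl fun y _ => mul_comm _ _
  -- As a matrix coefficient `⟨δ_x, F δ_y⟩`, the kernel inherits its hermitian symmetry from
  -- self-adjointness of the projection.
  · have key : ∀ x y, extendWords X m (F.starProjection (restrictWords X m (Pi.single y 1))) x =
        inner ℂ (restrictWords X m (Pi.single x 1))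
          (F.starProjection (restrictWords X m (Pi.single y 1))) := by
      intro x y
      by_cases hx : x.length = m
      · have : restrictWords X m (Pi.single x 1) =
            EuclideanSpace.single ⟨x, mem_words.2 hx⟩ (1 : ℂ) := by
          ext z
          rw [restrictWords_apply]
          simp [Pi.single_apply, Subtype.ext_iff]
        rw [this, EuclideanSpace.inner_single_left, extendWords_apply _ hx]
        simp
      · have : restrictWords X m (Pi.single x 1) = 0 := by
          ext z
          rw [restrictWords_apply, Pi.single_eq_of_ne]
          · rfl
          · intro h
            exact hx (h ▸ mem_words.1 z.2)
        rw [this, inner_zero_left, extendWords_of_length_ne _ hx]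
    simp only [key]
    rw [inner_conj_symm, F.inner_starProjection_left_eq_right]

variable (Γ n) in
/-- The matrix of the orthogonal projection onto the fixed vectors of length `m`. -/
def fixProj (m : ℕ) : List (Γ × n) → List (Γ × n) → ℂ :=
  (exists_projection_kernel (Γ × n) m (fixSpace Γ n m)
    fun _ => supportedOn_of_mem_fixSpace).choose

theorem fixProj_mem (m : ℕ) (y : List (Γ × n)) : (fun x => fixProj Γ n m x y) ∈ fixSpace Γ n m :=
  (exists_projection_kernel (Γ × n) m (fixSpace Γ n m)
    fun _ => supportedOn_of_mem_fixSpace).choose_spec.1 y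

theorem sum_fixProj_mul {m : ℕ} {f : List (Γ × n) → ℂ} (hf : f ∈ fixSpace Γ n m)
    (x : List (Γ × n)) : ∑ y ∈ words (Γ × n) m, fixProj Γ n m x y * f y = f x :=
  (exists_projection_kernel (Γ × n) m (fixSpace Γ n m)
    fun _ => supportedOn_of_mem_fixSpace).choose_spec.2.1 f hf x

theorem conj_fixProj (m : ℕ) (x y : List (Γ × n)) :
    conj (fixProj Γ n m x y) = fixProj Γ n m y x :=
  (exists_projection_kernel (Γ × n) m (fixSpace Γ n m)
    fun _ => supportedOn_of_mem_fixSpace).choose_spec.2.2 x y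

theorem sum_conj_mul_fixProj {m : ℕ} {f : List (Γ × n) → ℂ} (hf : f ∈ fixSpace Γ n m)
    (y : List (Γ × n)) :
    ∑ x ∈ words (Γ × n) m, conj (f x) * fixProj Γ n m x y = conj (f y) := by
  rw [← sum_fixProj_mul hf y, map_sum]
  exact Finset.sum_congr rfl fun x _ => by rw [map_mul, conj_fixProj, mul_comm]

/-- The fixed space is stable under the antiunitary `f ↦ conj (f ∘ conjWord)`, so its projection
commutes with it. Concretely, both entries are computed by the reproducing property, and the two
sums agree after the substitution `z ↦ conjWord z`. -/
theorem fixProj_conjWord {m : ℕ} {x y : List (Γ × n)} (hx : x.length = m) (hy : y.length = m) :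
    fixProj Γ n m (conjWord x) (conjWord y) = fixProj Γ n m y x := by
  obtain ⟨g, hg, h⟩ := exists_conj_mem_fixSpace (fixProj_mem m (conjWord y))
  have h1 := sum_conj_mul_fixProj hg x
  rw [h x hx, Complex.conj_conj] at h1
  rw [← h1]
  have h2 := sum_fixProj_mul (fixProj_mem m x) y
  obtain ⟨g', hg', h'⟩ := exists_conj_mem_fixSpace (fixProj_mem m x)
  have h3 := sum_conj_mul_fixProj hg' (conjWord y)
  rw [h' _ (by simpa using hy), Complex.conj_conj, conjWord_conjWord] at h3
  rw [← h3, ← sum_words_conj]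
  refine Finset.sum_congr rfl fun z hz => ?_
  rw [mem_words] at hz
  rw [h _ (by simpa using hz), h' _ hz, Complex.conj_conj, Complex.conj_conj,
    conjWord_conjWord, mul_comm]

/-- The vacuum expectation of the coefficient of index `(x, y)` of a tensor power. -/
def haar (x y : List (Γ × n)) : ℂ := fixProj Γ n x.length x y

theorem conj_haar {x y : List (Γ × n)} (h : x.length = y.length) : conj (haar x y) = haar y x := by
  rw [haar, conj_fixProj, haar, h]

theorem haar_conjWord {x y : List (Γ × n)} (h : x.length = y.length) :
    haar (conjWord x) (conjWord y) = haar y x := by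
  rw [haar, length_conjWord, fixProj_conjWord rfl h.symm, haar, h]

/-- Transposition of `cup` into a contraction. The values lie in a module so that it applies both to
scalars, in `sum_mul_cup`, and to coefficients of tensor powers. -/
theorem sum_cup_smul {M : Type*} [AddCommGroup M] [Module ℂ M] {p q : ℕ} (c : Γ)
    (G : List (Γ × n) → ℂ) (F : List (Γ × n) → M) :
    ∑ x ∈ words (Γ × n) (p + (q + 2)), cup p c G x • F x =
      ∑ x ∈ words (Γ × n) p, ∑ y ∈ words (Γ × n) q,
        G (x ++ y) • ∑ i, F (x ++ (c, i) :: (Duality.dual c, i) :: y) := by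
  rw [sum_words_add p]
  refine Finset.sum_congr rfl fun x hx => ?_
  rw [mem_words] at hx
  simp only [sum_words_succ, cup_append hx]
  simp only [ite_smul, zero_smul, ite_and]
  rw [Fintype.sum_prod_type, Finset.sum_eq_single c]
  · simp only [if_true, Finset.smul_sum]
    refine Eq.trans ?_ Finset.sum_comm
    refine Finset.sum_congr rfl fun i _ => ?_
    rw [Finset.sum_comm]
    refine Finset.sum_congr rfl fun z _ => ?_
    rw [Finset.sum_ite_eq' Finset.univ (flip (c, i)) fun t =>
      G (x ++ z) • F (x ++ (c, i) :: t :: z)]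
    simp [flip]
  · intro d _ hd
    simp [hd]
  · simp

theorem sum_mul_cup {p q : ℕ} (c : Γ) (F G : List (Γ × n) → ℂ) :
    ∑ x ∈ words (Γ × n) (p + (q + 2)), F x * cup p c G x =
      ∑ x ∈ words (Γ × n) (p + q), cap p c F x * G x := by
  rw [Finset.sum_congr rfl fun x _ => mul_comm (F x) _]
  refine (sum_cup_smul c G F).trans ?_
  rw [sum_words_add p]
  refine Finset.sum_congr rfl fun x hx => Finset.sum_congr rfl fun y _ => ?_
  rw [cap_append (mem_words.1 hx), smul_eq_mul, mul_comm]

/-- The projections onto the fixed vectors commute with the insertion of strings. -/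
theorem sum_haar_pair_right {x y z t : List (Γ × n)} (hx : x.length = y.length)
    (hz : z.length = t.length) (a b : Γ × n) (c : Γ) :
    ∑ i, haar (x ++ a :: b :: z) (y ++ (c, i) :: (Duality.dual c, i) :: t) =
      if a.1 = c ∧ b = flip a then haar (x ++ z) (y ++ t) else 0 := by
  set p := x.length
  set q := z.length
  set w := x ++ a :: b :: z
  have hw : w.length = p + (q + 2) := by simp [w, p, q]
  -- Both sides of the claim are the entry `(w, y ++ t)` of `P ∘ cup ∘ P`. Stability under caps
  -- removes the right-hand projection (`h1`), and stability under cups removes the left-hand one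
  -- (`h3`).
  have hg : cap p c (fun v => fixProj Γ n (p + q + 2) v w) ∈ fixSpace Γ n (p + q) :=
    cap_mem_fixSpace (by omega) c (fixProj_mem _ _)
  have h1 := sum_conj_mul_fixProj hg (y ++ t)
  have h2 : ∀ v, conj (cap p c (fun v => fixProj Γ n (p + q + 2) v w) v) =
      cap p c (fun v => fixProj Γ n (p + q + 2) w v) v := fun v => by
    simp [cap, map_sum, conj_fixProj]
  simp only [h2] at h1
  rw [cap_append hx.symm, ← sum_mul_cup] at h1
  have h3 := sum_fixProj_mul (cup_mem_fixSpace (p := p) (by omega) c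
    (fixProj_mem (p + q) (y ++ t))) w
  rw [add_assoc p q 2] at h1 h3
  rw [h3, cup_append rfl] at h1
  simp only [haar, hw, List.length_append]
  exact h1.symm

theorem sum_haar_pair_left {x y z t : List (Γ × n)} (hx : x.length = y.length)
    (hz : z.length = t.length) (a b : Γ × n) (c : Γ) :
    ∑ i, haar (y ++ (c, i) :: (Duality.dual c, i) :: t) (x ++ a :: b :: z) =
      if a.1 = c ∧ b = flip a then haar (y ++ t) (x ++ z) else 0 := by
  have := congrArg conj (sum_haar_pair_right hx hz a b c)
  rw [map_sum, apply_ite conj, map_zero, conj_haar (by simp [hx, hz])] at this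
  rw [← this]
  exact Finset.sum_congr rfl fun i _ => by rw [conj_haar (by simp [hx, hz])]

theorem haar_nil : haar ([] : List (Γ × n)) [] = 1 := by
  have := sum_fixProj_mul (Γ := Γ) (n := n) nil_mem_fixSpace []
  rw [sum_words_zero] at this
  simpa [haar] using this

end FixSpace

/-! ### Averaging over a Parseval family of a matrix *-algebra -/

section Parseval

open scoped ComplexOrder

variable {ι A : Type*} [Fintype ι] [DecidableEq ι] [Fintype A] {C : Set (Matrix ι ι ℂ)}
  {T : A → Matrix ι ι ℂ}

/-- Averaging over a family of matrices. -/
def average (T : A → Matrix ι ι ℂ) (x : Matrix ι ι ℂ) : Matrix ι ι ℂ := ∑ v, (T v)ᴴ * x * T v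

theorem sum_trace_smul_conjTranspose (hP : ∀ K ∈ C, ∑ v, ((T v)ᴴ * K).trace • T v = K)
    {K : Matrix ι ι ℂ} (hK : K ∈ C) : ∑ v, (Kᴴ * T v).trace • (T v)ᴴ = Kᴴ := by
  conv_rhs => rw [← hP K hK, Matrix.conjTranspose_sum]
  refine Finset.sum_congr rfl fun v _ => ?_
  rw [Matrix.conjTranspose_smul, ← Matrix.trace_conjTranspose, Matrix.conjTranspose_mul,
    Matrix.conjTranspose_conjTranspose]

/-- Expand `T v * K` on one side and `K * (T u)ᴴ` on the other in the Parseval family: both products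
become the same double sum, with coefficients `tr((T u)ᴴ T v K)`. -/
theorem average_commute (hT : ∀ v, T v ∈ C) (hmul : ∀ K ∈ C, ∀ K' ∈ C, K * K' ∈ C)
    (hstar : ∀ K ∈ C, Kᴴ ∈ C) (hP : ∀ K ∈ C, ∑ v, ((T v)ᴴ * K).trace • T v = K)
    (x : Matrix ι ι ℂ) {K : Matrix ι ι ℂ} (hK : K ∈ C) : average T x * K = K * average T x := by
  have h1 : ∀ v, (T v)ᴴ * x * T v * K =
      ∑ u, ((T u)ᴴ * T v * K).trace • ((T v)ᴴ * x * T u) := fun v => by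
    conv_lhs => rw [Matrix.mul_assoc, ← hP _ (hmul _ (hT v) _ hK), Finset.mul_sum]
    simp [Matrix.mul_assoc]
  have h2 : ∀ u, K * ((T u)ᴴ * x * T u) =
      ∑ v, ((T u)ᴴ * T v * K).trace • ((T v)ᴴ * x * T u) := fun u => by
    have := sum_trace_smul_conjTranspose hP (hmul _ (hT u) _ (hstar _ hK))
    rw [Matrix.conjTranspose_mul, Matrix.conjTranspose_conjTranspose] at this
    rw [← Matrix.mul_assoc, ← Matrix.mul_assoc, ← this, Finset.sum_mul, Finset.sum_mul]
    refine Finset.sum_congr rfl fun v _ => ?_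
    rw [Matrix.smul_mul, Matrix.smul_mul, Matrix.mul_assoc K, Matrix.trace_mul_comm K]
  rw [average, Finset.sum_mul, Finset.mul_sum, Finset.sum_congr rfl fun v _ => h1 v,
    Finset.sum_congr rfl fun v _ => h2 v, Finset.sum_comm]

/-- Since `C` is stable under adjoints, each `(T v)ᴴ` can be expanded in the family. The
coefficients are symmetric in `u` and `v`, which exchanges the two forms. This makes averaging
self-adjoint for the trace form. -/
theorem average_eq_sum (hT : ∀ v, T v ∈ C) (hstar : ∀ K ∈ C, Kᴴ ∈ C)
    (hP : ∀ K ∈ C, ∑ v, ((T v)ᴴ * K).trace • T v = K) (x : Matrix ι ι ℂ) :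
    average T x = ∑ v, T v * x * (T v)ᴴ := by
  have h1 : ∀ v, (T v)ᴴ * x * T v = ∑ u, ((T u)ᴴ * (T v)ᴴ).trace • (T u * x * T v) := fun v => by
    conv_lhs => rw [← hP _ (hstar _ (hT v)), Finset.sum_mul, Finset.sum_mul]
    simp
  have h2 : ∀ u, T u * x * (T u)ᴴ = ∑ v, ((T u)ᴴ * (T v)ᴴ).trace • (T u * x * T v) := fun u => by
    conv_lhs => rw [← hP _ (hstar _ (hT u)), Finset.mul_sum]
    refine Finset.sum_congr rfl fun v _ => ?_
    rw [Matrix.mul_smul, Matrix.trace_mul_comm]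
  rw [average, Finset.sum_congr rfl fun v _ => h1 v, Finset.sum_congr rfl fun v _ => h2 v,
    Finset.sum_comm]

/-- A vector `x` in the kernel satisfies `∑ ‖T v x‖² = 0`, so every `T v` kills `x`; the identity is
a combination of the `T v`, hence `x = 0`. -/
theorem isUnit_average_one (hone : 1 ∈ C) (hP : ∀ K ∈ C, ∑ v, ((T v)ᴴ * K).trace • T v = K) :
    IsUnit (average T 1) := by
  refine Matrix.mulVec_injective_iff_isUnit.1 <|
    (injective_iff_map_eq_zero (Matrix.mulVecLin (average T 1))).2 fun x hx => ?_
  have h1 : ∑ v, star (T v *ᵥ x) ⬝ᵥ (T v *ᵥ x) = 0 := by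
    have : star x ⬝ᵥ (average T 1 *ᵥ x) = 0 := by
      rw [Matrix.mulVecLin_apply] at hx
      rw [hx, dotProduct_zero]
    rw [← this, average, Matrix.sum_mulVec, dotProduct_sum]
    refine Finset.sum_congr rfl fun v _ => ?_
    rw [Matrix.mul_one, ← Matrix.mulVec_mulVec, Matrix.star_mulVec, Matrix.dotProduct_mulVec,
      Matrix.dotProduct_mulVec, Matrix.dotProduct_mulVec]
  have h2 : ∀ v, T v *ᵥ x = 0 := fun v =>
    dotProduct_star_self_eq_zero.1
      ((Finset.sum_eq_zero_iff_of_nonneg fun v _ => dotProduct_star_self_nonneg _).1 h1 v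
        (Finset.mem_univ v))
  have h3 := congrArg (· *ᵥ x) (hP 1 hone)
  simp only [Matrix.sum_mulVec, Matrix.smul_mulVec, h2, smul_zero, Finset.sum_const_zero,
    Matrix.one_mulVec] at h3
  exact h3.symm

/-- With `Φ` the averaging map and `M = Φ(1)`, the matrix `d = Φ(c) M⁻¹` lies in the commutant of
`C`, so `Φ(d) = d M = Φ(c)`. Self-adjointness of `Φ` gives `tr(cᴴ Φ(c)) = tr(Φ(c)ᴴ d) = tr(M dᴴ d)`,
a sum of traces of positive matrices. -/
theorem trace_average_nonneg (hT : ∀ v, T v ∈ C) (hmul : ∀ K ∈ C, ∀ K' ∈ C, K * K' ∈ C)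
    (hstar : ∀ K ∈ C, Kᴴ ∈ C) (hone : 1 ∈ C) (hP : ∀ K ∈ C, ∑ v, ((T v)ᴴ * K).trace • T v = K) (c : Matrix ι ι ℂ) : 0 ≤ (cᴴ * average T c).trace := by
  have hM := (Matrix.isUnit_iff_isUnit_det _).1 (isUnit_average_one hone hP)
  have hcomm := fun x K hK => average_commute hT hmul hstar hP x (K := K) hK
  set M := average T 1
  set d := average T c * M⁻¹
  have hdM : d * M = average T c := by
    rw [Matrix.mul_assoc, Matrix.nonsing_inv_mul _ hM, Matrix.mul_one]
  have hinv : ∀ K ∈ C, M⁻¹ * K = K * M⁻¹ := fun K hK => by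
    have := hcomm 1 K hK
    calc M⁻¹ * K = M⁻¹ * (K * M) * M⁻¹ := by
          rw [Matrix.mul_assoc, Matrix.mul_assoc, Matrix.mul_nonsing_inv _ hM, Matrix.mul_one]
      _ = K * M⁻¹ := by
          rw [← this, ← Matrix.mul_assoc, Matrix.nonsing_inv_mul _ hM, Matrix.one_mul]
  have hd : ∀ K ∈ C, d * K = K * d := fun K hK => by
    rw [Matrix.mul_assoc, hinv K hK, ← Matrix.mul_assoc, hcomm c K hK, Matrix.mul_assoc]
  have hΦd : average T d = average T c := by
    rw [← hdM]
    simp only [M, average, Finset.mul_sum]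
    refine Finset.sum_congr rfl fun v _ => ?_
    rw [← hd _ (hstar _ (hT v)), Matrix.mul_assoc, Matrix.mul_one]
  have hself : (cᴴ * average T d).trace = ((average T c)ᴴ * d).trace := by
    rw [average_eq_sum hT hstar hP d]
    simp only [average, Matrix.conjTranspose_sum, Finset.sum_mul, Finset.mul_sum,
      Matrix.trace_sum]
    refine Finset.sum_congr rfl fun v _ => ?_
    rw [Matrix.conjTranspose_mul, Matrix.conjTranspose_mul, Matrix.conjTranspose_conjTranspose,
      Matrix.mul_assoc (T v)ᴴ, Matrix.trace_mul_comm (T v)ᴴ]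
    simp only [Matrix.mul_assoc]
  have hMH : Mᴴ = M := by
    simp [M, average, Matrix.conjTranspose_sum]
  rw [← hΦd, hself, ← hdM, Matrix.conjTranspose_mul, hMH]
  simp only [M, average, Finset.sum_mul, Matrix.trace_sum]
  refine Finset.sum_nonneg fun v _ => ?_
  have : ∀ a : Matrix ι ι ℂ, ((T v)ᴴ * 1 * T v * aᴴ * a).trace =
      ((a * (T v)ᴴ)ᴴ * (a * (T v)ᴴ)).trace := fun a => by
    rw [Matrix.mul_one, Matrix.mul_assoc, Matrix.mul_assoc, Matrix.trace_mul_comm,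
      Matrix.conjTranspose_mul, Matrix.conjTranspose_conjTranspose]
    simp only [Matrix.mul_assoc]
  rw [this]
  exact (Matrix.posSemidef_conjTranspose_mul_self _).trace_nonneg

end Parseval

/-! ### Positivity of the vacuum functional -/

section Positivity

open scoped ComplexOrder ComplexConjugate

variable {Γ n : Type} [Duality Γ] [DecidableEq Γ] [DecidableEq n] [Fintype Γ] [Fintype n]

variable (Γ n) in
/-- The words of length at most `L`. -/
def boundedWords (L : ℕ) : Finset (List (Γ × n)) :=
  (Finset.range (L + 1)).biUnion (words (Γ × n))

theorem mem_boundedWords {L : ℕ} {x : List (Γ × n)} : x ∈ boundedWords Γ n L ↔ x.length ≤ L := by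
  simp [boundedWords, mem_words]

theorem sum_boundedWords {M : Type*} [AddCommMonoid M] (L : ℕ) (F : List (Γ × n) → M) :
    ∑ x : boundedWords Γ n L, F x = ∑ r ∈ Finset.range (L + 1), ∑ x ∈ words (Γ × n) r, F x := by
  rw [Finset.sum_coe_sort (boundedWords Γ n L) F, boundedWords, Finset.sum_biUnion]
  intro r _ r' _ h
  rw [Function.onFun, Finset.disjoint_left]
  intro x hx hx'
  exact h (by rw [← mem_words.1 hx, ← mem_words.1 hx'])

theorem sum_boundedWords_ite {M : Type*} [AddCommMonoid M] {L m : ℕ} (hm : m ≤ L)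
    (F : List (Γ × n) → M) :
    ∑ x : boundedWords Γ n L, (if x.1.length = m then F x else 0) =
      ∑ x ∈ words (Γ × n) m, F x := by
  rw [sum_boundedWords L fun x => if x.length = m then F x else 0, Finset.sum_eq_single m]
  · exact Finset.sum_congr rfl fun x hx => if_pos (mem_words.1 hx)
  · intro r _ hr
    refine Finset.sum_eq_zero fun x hx => if_neg ?_
    rwa [mem_words.1 hx]
  · intro h
    exact absurd (Finset.mem_range.2 (by omega)) h

variable (Γ n) in
/-- The algebra of the intertwiners between tensor powers of length at most `L`. -/
def intertwiners (L : ℕ) : Set (Matrix (boundedWords Γ n L) (boundedWords Γ n L) ℂ) :=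
  {K | ∀ m q, m ≤ L → q ≤ L → ∃ f ∈ fixSpace Γ n (m + q), ∀ x y : boundedWords Γ n L,
    x.1.length = m → y.1.length = q → K y x = f (conjWord x.1 ++ y.1)}

/-- The part of the product passing through words of length `r` is a composition of bent
intertwiners, and one sums over `r ≤ L`. The truncation by `L` makes the middle sum finite. -/
theorem mul_mem_intertwiners {L : ℕ} {K K' : Matrix (boundedWords Γ n L) (boundedWords Γ n L) ℂ}
    (hK : K ∈ intertwiners Γ n L) (hK' : K' ∈ intertwiners Γ n L) :
    K * K' ∈ intertwiners Γ n L := by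
  intro m q hm hq
  have key : ∀ r, ∃ h ∈ fixSpace Γ n (m + q), r ≤ L → ∀ x z : boundedWords Γ n L,
      x.1.length = m → z.1.length = q → h (conjWord x.1 ++ z.1) =
        ∑ y : boundedWords Γ n L, if y.1.length = r then K z y * K' y x else 0 := by
    intro r
    by_cases hr : r ≤ L
    · obtain ⟨f, hf, e⟩ := hK r q hr hq
      obtain ⟨f', hf', e'⟩ := hK' m r hm hr
      obtain ⟨h, hh, e''⟩ := exists_comp_mem_fixSpace hf' hf
      refine ⟨h, hh, fun _ x z hx hz => ?_⟩
      rw [e'' _ _ (by simpa using hx) hz, ← sum_boundedWords_ite hr]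
      refine Finset.sum_congr rfl fun y _ => ?_
      split_ifs with hy
      · rw [e _ _ hy hz, e' _ _ hx hy, mul_comm]
      · rfl
    · exact ⟨0, zero_mem _, fun h => absurd h hr⟩
  choose h hh e using key
  refine ⟨∑ r ∈ Finset.range (L + 1), h r, sum_mem fun r _ => hh r, fun x z hx hz => ?_⟩
  rw [Finset.sum_apply, Finset.sum_congr rfl fun r hr =>
    e r (Nat.lt_succ_iff.1 (Finset.mem_range.1 hr)) x z hx hz, Finset.sum_comm, Matrix.mul_apply]
  refine Finset.sum_congr rfl fun y _ => ?_
  rw [Finset.sum_ite_eq, if_pos]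
  have := mem_boundedWords.1 y.2
  exact Finset.mem_range.2 (by omega)

theorem conjTranspose_mem_intertwiners {L : ℕ}
    {K : Matrix (boundedWords Γ n L) (boundedWords Γ n L) ℂ} (hK : K ∈ intertwiners Γ n L) :
    Kᴴ ∈ intertwiners Γ n L := by
  intro m q hm hq
  obtain ⟨f, hf, e⟩ := hK q m hq hm
  obtain ⟨g, hg, e'⟩ := exists_conj_mem_fixSpace hf
  refine ⟨g, add_comm q m ▸ hg, fun x y hx hy => ?_⟩
  rw [e' _ (by simp [hx, hy, add_comm]), Matrix.conjTranspose_apply, e y x hy hx]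
  simp

theorem one_mem_intertwiners (L : ℕ) : 1 ∈ intertwiners Γ n L := by
  intro m q hm hq
  by_cases h : m = q
  · subst h
    obtain ⟨f, hf, e⟩ := exists_id_mem_fixSpace (Γ := Γ) (n := n) m
    refine ⟨f, hf, fun x y hx hy => ?_⟩
    rw [e _ _ hx hy, Matrix.one_apply]
    by_cases h : y = x
    · simp [h]
    · rw [if_neg h, if_neg fun h' => h (Subtype.ext h'.symm)]
  · refine ⟨0, zero_mem _, fun x y hx hy => ?_⟩
    rw [Matrix.one_apply_ne]
    · rfl
    · rintro rfl
      exact h (hx.symm.trans hy)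

/-- The orthogonal projections of the matrix units onto the intertwiners. -/
def unitProj (L : ℕ) (v : boundedWords Γ n L × boundedWords Γ n L) :
    Matrix (boundedWords Γ n L) (boundedWords Γ n L) ℂ :=
  Matrix.of fun y x => if x.1.length = v.1.1.length then if y.1.length = v.2.1.length then
    haar (conjWord x.1 ++ y.1) (conjWord v.1.1 ++ v.2.1) else 0 else 0

theorem unitProj_mem (L : ℕ) (v : boundedWords Γ n L × boundedWords Γ n L) :
    unitProj L v ∈ intertwiners Γ n L := by
  intro m q hm hq
  by_cases h : m = v.1.1.length ∧ q = v.2.1.length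
  · refine ⟨_, fixProj_mem (m + q) (conjWord v.1.1 ++ v.2.1), fun x y hx hy => ?_⟩
    simp [unitProj, hx, hy, h.1, h.2, haar]
  · refine ⟨0, zero_mem _, fun x y hx hy => ?_⟩
    simp only [unitProj, Matrix.of_apply, hx, hy, Pi.zero_apply]
    split_ifs with h1 h2
    · exact absurd ⟨h1, h2⟩ h
    · rfl
    · rfl

theorem sum_haar_mul {m q : ℕ} {f : List (Γ × n) → ℂ} (hf : f ∈ fixSpace Γ n (m + q))
    {z : List (Γ × n)} (hz : z.length = m + q) :
    ∑ x ∈ words (Γ × n) m, ∑ y ∈ words (Γ × n) q,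
      haar z (conjWord x ++ y) * f (conjWord x ++ y) = f z := by
  rw [sum_words_conj m fun x => ∑ y ∈ words (Γ × n) q, haar z (x ++ y) * f (x ++ y),
    ← sum_words_add m q fun w => haar z w * f w]
  simp only [haar, hz]
  exact sum_fixProj_mul hf z

theorem sum_pairs_ite {L m q : ℕ} (hm : m ≤ L) (hq : q ≤ L)
    (F : List (Γ × n) → List (Γ × n) → ℂ) :
    ∑ v : boundedWords Γ n L × boundedWords Γ n L, (if v.1.1.length = m then
      if v.2.1.length = q then F v.1 v.2 else 0 else 0) =
      ∑ x ∈ words (Γ × n) m, ∑ y ∈ words (Γ × n) q, F x y := by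
  rw [Fintype.sum_prod_type, ← sum_boundedWords_ite hm]
  refine Finset.sum_congr rfl fun x _ => ?_
  split_ifs
  · rw [← sum_boundedWords_ite hq]
  · simp

/-- `unitProj L v` is the projection of the matrix unit at `(v.2, v.1)`, so pairing it with an
element of the algebra gives the same as pairing the matrix unit itself. -/
theorem trace_unitProj_mul {L : ℕ} {K : Matrix (boundedWords Γ n L) (boundedWords Γ n L) ℂ}
    (hK : K ∈ intertwiners Γ n L) (v : boundedWords Γ n L × boundedWords Γ n L) :
    ((unitProj L v)ᴴ * K).trace = K v.2 v.1 := by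
  have h1 := mem_boundedWords.1 v.1.2
  have h2 := mem_boundedWords.1 v.2.2
  obtain ⟨f, hf, e⟩ := hK _ _ h1 h2
  rw [e _ _ rfl rfl, ← sum_haar_mul hf (by simp), ← sum_pairs_ite h1 h2, Fintype.sum_prod_type]
  simp only [Matrix.trace, Matrix.diag_apply, Matrix.mul_apply]
  refine Finset.sum_congr rfl fun x _ => Finset.sum_congr rfl fun y _ => ?_
  simp only [Matrix.conjTranspose_apply, unitProj, Matrix.of_apply]
  split_ifs with hx hy
  · rw [e _ _ hx hy, Complex.star_def, conj_haar (by simp [hx, hy])]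
  · simp
  · simp

theorem sum_trace_smul_unitProj {L : ℕ} {K : Matrix (boundedWords Γ n L) (boundedWords Γ n L) ℂ}
    (hK : K ∈ intertwiners Γ n L) : ∑ v, ((unitProj L v)ᴴ * K).trace • unitProj L v = K := by
  ext y x
  have h1 := mem_boundedWords.1 x.2
  have h2 := mem_boundedWords.1 y.2
  obtain ⟨f, hf, e⟩ := hK _ _ h1 h2
  rw [e _ _ rfl rfl, ← sum_haar_mul hf (by simp), ← sum_pairs_ite h1 h2, Matrix.sum_apply]
  refine Finset.sum_congr rfl fun v _ => ?_
  rw [trace_unitProj_mul hK, Matrix.smul_apply, smul_eq_mul, unitProj, Matrix.of_apply]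
  simp only [eq_comm (a := x.1.length), eq_comm (a := y.1.length)]
  split_ifs with h h'
  · rw [e _ _ h h', mul_comm]
  · simp
  · simp

/-- This is `P = P P`, with `P` the projection onto fixed vectors of length `|x| + |x'|` and the
middle index written as a bent pair of words. -/
theorem sum_unitProj_mul_conj {L : ℕ} {x x' y y' : boundedWords Γ n L}
    (h : x.1.length = y.1.length) (h' : x'.1.length = y'.1.length) :
    ∑ v, unitProj L v x' x * conj (unitProj L v y' y) =
      haar (conjWord x.1 ++ x'.1) (conjWord y.1 ++ y'.1) := by
  have h1 := mem_boundedWords.1 x.2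
  have h2 := mem_boundedWords.1 x'.2
  have := sum_haar_mul (m := x.1.length) (q := x'.1.length)
    (fixProj_mem _ (conjWord y.1 ++ y'.1)) (z := conjWord x.1 ++ x'.1) (by simp)
  rw [haar, List.length_append, length_conjWord, ← this, ← sum_pairs_ite h1 h2]
  refine Finset.sum_congr rfl fun v _ => ?_
  simp only [unitProj, Matrix.of_apply, eq_comm (b := v.1.1.length), eq_comm (b := v.2.1.length),
    ← h, ← h']
  split_ifs with h3 h4
  · rw [conj_haar (by simp [h, h', h3, h4]), haar, haar]
    simp [h3, h4]
  · simp
  · simp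

/-- The product `(u_{x_j y_j})* u_{x_k y_k}` is the coefficient of index `(conjWord x_j ++ x_k,
conjWord y_j ++ y_k)`, so this is positivity of the state on the element `∑ c_j u_{x_j y_j}`. By
`sum_unitProj_mul_conj` the form is `tr(Mᴴ Φ(M))` with `M = ∑ c_j E_{y_j x_j}`, on words short
enough to include all those in play. -/
theorem haar_form_nonneg {J : Type*} (s : Finset J) (c : J → ℂ) (x y : J → List (Γ × n))
    (h : ∀ j, (x j).length = (y j).length) :
    0 ≤ ∑ j ∈ s, ∑ k ∈ s, conj (c j) * c k *
      haar (conjWord (x j) ++ x k) (conjWord (y j) ++ y k) := by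
  set L := s.sup fun j => (x j).length
  have hx : ∀ j : s, x j ∈ boundedWords Γ n L := fun j =>
    mem_boundedWords.2 (Finset.le_sup (f := fun j => (x j).length) j.2)
  have hy : ∀ j : s, y j ∈ boundedWords Γ n L := fun j => by
    have := mem_boundedWords.1 (hx j)
    exact mem_boundedWords.2 (by rwa [← h])
  set M : Matrix (boundedWords Γ n L) (boundedWords Γ n L) ℂ :=
    ∑ j : s, Matrix.single ⟨y j, hy j⟩ ⟨x j, hx j⟩ (c j)
  have key := trace_average_nonneg (T := unitProj L) (unitProj_mem L)
    (fun K hK K' hK' => mul_mem_intertwiners hK hK')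
    (fun K hK => conjTranspose_mem_intertwiners hK) (one_mem_intertwiners L)
    (fun K hK => sum_trace_smul_unitProj hK)
    M
  convert key using 1
  simp only [average, M, Matrix.conjTranspose_sum, Finset.mul_sum, Finset.sum_mul,
    Matrix.trace_sum, Matrix.conjTranspose_single]
  rw [← Finset.sum_coe_sort s]
  simp only [← Finset.sum_coe_sort s fun k => _ * _ * haar _ (_ ++ y k)]
  have rotate : ∀ F : s → s → boundedWords Γ n L × boundedWords Γ n L → ℂ,
      ∑ j, ∑ k, ∑ v, F j k v = ∑ v, ∑ k, ∑ j, F j k v := fun F =>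
    (Finset.sum_congr rfl fun j _ => Finset.sum_comm).trans
      (Finset.sum_comm.trans (Finset.sum_congr rfl fun v _ => Finset.sum_comm))
  rw [← rotate]
  refine Finset.sum_congr rfl fun j _ => Finset.sum_congr rfl fun k _ => ?_
  rw [← sum_unitProj_mul_conj (x := ⟨x j, hx j⟩) (x' := ⟨x k, hx k⟩) (y := ⟨y j, hy j⟩)
    (y' := ⟨y k, hy k⟩) (h j) (h k), Finset.mul_sum]
  refine Finset.sum_congr rfl fun v _ => ?_
  rw [← Matrix.mul_assoc, ← Matrix.mul_assoc, Matrix.single_mul_mul_single,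
    Matrix.trace_single_mul, Matrix.conjTranspose_apply, Complex.star_def, smul_eq_mul]
  ring

end Positivity

/-! ### Families of conjugate unitary matrices -/

/-- The matrices `v c` are unitary, and the entries of `v (dual c)` are the adjoints of those
of `v c`. -/
structure IsColoredUnitary {Γ n B : Type*} [Fintype n] [DecidableEq n] [Ring B] [StarRing B]
    (dual : Γ → Γ) (v : Γ → Matrix n n B) : Prop where
  star_apply : ∀ c i j, star (v c i j) = v (dual c) i j
  sum_row : ∀ c i j, ∑ k, v c i k * v (dual c) j k = if i = j then 1 else 0
  sum_col : ∀ c i j, ∑ k, v c k i * v (dual c) k j = if i = j then 1 else 0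

/-- The coefficient of index `(x, y)` of the tensor powers of the matrices `v c`. -/
def tensorCoeff {Γ n B : Type*} [DecidableEq Γ] [Ring B] (v : Γ → Matrix n n B) :
    List (Γ × n) → List (Γ × n) → B
  | a :: x, b :: y => (if a.1 = b.1 then v a.1 a.2 b.2 else 0) * tensorCoeff v x y
  | [], [] => 1
  | _, _ => 0

/-! ### The Hilbert space completion of the free *-algebra -/

section GNS

open scoped ComplexOrder ComplexConjugate

/-- The free algebra with generators `u^c_{ij}`, with basis the words `u^{c₁}_{i₁j₁} ⋯ u^{cₘ}_{iₘjₘ}`. -/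
def PreGNS (Γ n : Type) : Type := List (Γ × n × n) →₀ ℂ

instance (Γ n : Type) : AddCommGroup (PreGNS Γ n) :=
  inferInstanceAs (AddCommGroup (List (Γ × n × n) →₀ ℂ))

instance (Γ n : Type) : Module ℂ (PreGNS Γ n) :=
  inferInstanceAs (Module ℂ (List (Γ × n × n) →₀ ℂ))

/-- The row index of a word in the generators. -/
def rowIndex {Γ n : Type} (m : List (Γ × n × n)) : List (Γ × n) := m.map fun z => (z.1, z.2.1)

/-- The column index of a word in the generators. -/
def colIndex {Γ n : Type} (m : List (Γ × n × n)) : List (Γ × n) := m.map fun z => (z.1, z.2.2)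

theorem length_rowIndex {Γ n : Type} (m : List (Γ × n × n)) :
    (rowIndex m).length = (colIndex m).length := by
  simp [rowIndex, colIndex]

variable {Γ n : Type} [Duality Γ] [DecidableEq Γ] [DecidableEq n] [Fintype Γ] [Fintype n]

/-- The inner product of two words. -/
def gnsKernel (m m' : List (Γ × n × n)) : ℂ :=
  haar (conjWord (rowIndex m) ++ rowIndex m') (conjWord (colIndex m) ++ colIndex m')

theorem conj_gnsKernel (m m' : List (Γ × n × n)) : conj (gnsKernel m m') = gnsKernel m' m := by
  have h := length_rowIndex m
  have h' := length_rowIndex m'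
  rw [gnsKernel, conj_haar (by simp [h, h']), ← haar_conjWord (by simp [h, h']), gnsKernel]
  simp

/-- A letter moves across the inner product to its conjugate: this encodes that the adjoint of
`u^c_{ij}` is `u^{dual c}_{ij}`. -/
theorem gnsKernel_cons (z : Γ × n × n) (m m' : List (Γ × n × n)) :
    gnsKernel (z :: m) m' = gnsKernel m ((Duality.dual z.1, z.2) :: m') := by
  simp [gnsKernel, rowIndex, colIndex, flip]

theorem sum_gnsKernel_row (c : Γ) (i j : n) (m m' : List (Γ × n × n)) :
    ∑ k, gnsKernel m ((c, i, k) :: (Duality.dual c, j, k) :: m') =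
      if i = j then gnsKernel m m' else 0 := by
  have := sum_haar_pair_right (x := conjWord (rowIndex m)) (y := conjWord (colIndex m))
    (z := rowIndex m') (t := colIndex m') (by simp [length_rowIndex]) (length_rowIndex m')
    (c, i) (Duality.dual c, j) c
  simpa [gnsKernel, rowIndex, colIndex, flip, eq_comm] using this

theorem sum_gnsKernel_col (c : Γ) (i j : n) (m m' : List (Γ × n × n)) :
    ∑ k, gnsKernel m ((c, k, i) :: (Duality.dual c, k, j) :: m') =
      if i = j then gnsKernel m m' else 0 := by
  have := sum_haar_pair_left (y := conjWord (rowIndex m)) (x := conjWord (colIndex m))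
    (t := rowIndex m') (z := colIndex m') (by simp [length_rowIndex]) (length_rowIndex m').symm
    (c, i) (Duality.dual c, j) c
  simpa [gnsKernel, rowIndex, colIndex, flip, eq_comm] using this

/-- The linear form `⟨m, ·⟩`, for a word `m`. -/
def gnsForm (m : List (Γ × n × n)) : PreGNS Γ n →ₗ[ℂ] ℂ :=
  Finsupp.linearCombination ℂ (gnsKernel m)

/-- The inner product on the free algebra. -/
def gnsInner (a b : PreGNS Γ n) : ℂ := Finsupp.sum a fun m r => conj r * gnsForm m b

theorem gnsInner_eq_sum (a b : PreGNS Γ n) :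
    gnsInner a b = Finsupp.sum a fun m r => Finsupp.sum b fun m' r' =>
      conj r * r' * gnsKernel m m' := by
  refine Finset.sum_congr rfl fun m _ => ?_
  have : gnsForm m b = Finsupp.sum b fun m' r' => r' * gnsKernel m m' :=
    Finsupp.linearCombination_apply _ _
  simp only [this, Finsupp.sum, Finset.mul_sum, mul_assoc]

theorem gnsInner_add_left (a b c : PreGNS Γ n) :
    gnsInner (a + b) c = gnsInner a c + gnsInner b c :=
  Finsupp.sum_add_index' (by simp) (by simp [add_mul])

theorem gnsInner_smul_left (r : ℂ) (a b : PreGNS Γ n) :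
    gnsInner (r • a) b = conj r * gnsInner a b := by
  refine (Finsupp.sum_smul_index (by simp)).trans ?_
  simp [gnsInner, Finsupp.sum, Finset.mul_sum, mul_assoc]

theorem conj_gnsInner (a b : PreGNS Γ n) : conj (gnsInner a b) = gnsInner b a := by
  rw [gnsInner_eq_sum, gnsInner_eq_sum]
  simp only [Finsupp.sum, map_sum, map_mul, conj_gnsKernel, Complex.conj_conj]
  rw [Finset.sum_comm]
  exact Finset.sum_congr rfl fun m _ => Finset.sum_congr rfl fun m' _ => by ring

theorem gnsInner_self_nonneg (a : PreGNS Γ n) : 0 ≤ gnsInner a a := by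
  rw [gnsInner_eq_sum]
  exact haar_form_nonneg _ (fun m => (show List (Γ × n × n) →₀ ℂ from a) m) rowIndex colIndex
    length_rowIndex

variable (Γ n) in
/-- The inner product defined by the vacuum state. -/
abbrev preGNSCore : PreInnerProductSpace.Core ℂ (PreGNS Γ n) where
  inner := gnsInner
  conj_inner_symm a b := conj_gnsInner b a
  re_inner_nonneg a := (Complex.nonneg_iff.1 (gnsInner_self_nonneg a)).1
  add_left := gnsInner_add_left
  smul_left a b r := gnsInner_smul_left r a b

instance : SeminormedAddCommGroup (PreGNS Γ n) :=
  InnerProductSpace.Core.toSeminormedAddCommGroup (c := preGNSCore Γ n)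

instance : InnerProductSpace ℂ (PreGNS Γ n) := InnerProductSpace.ofCore (preGNSCore Γ n)

theorem preGNS_inner_def (a b : PreGNS Γ n) : inner ℂ a b = gnsInner a b := rfl

/-- A word, as an element of the free algebra. -/
def gnsWord (m : List (Γ × n × n)) : PreGNS Γ n := Finsupp.single m 1

theorem inner_gnsWord (m m' : List (Γ × n × n)) :
    inner ℂ (gnsWord m) (gnsWord m') = gnsKernel m m' := by
  rw [preGNS_inner_def, gnsInner_eq_sum]
  simp [gnsWord]

theorem preGNS_ext {M : Type*} [AddCommMonoid M] [Module ℂ M] {f g : PreGNS Γ n →ₗ[ℂ] M}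
    (h : ∀ m, f (gnsWord m) = g (gnsWord m)) : f = g :=
  Finsupp.lhom_ext' fun m => LinearMap.ext_ring (h m)

/-- The form may be degenerate, so identities between operators on the free algebra are only
asserted inside inner products, where testing on words is enough. -/
theorem inner_ext_word {f g : PreGNS Γ n →ₗ[ℂ] PreGNS Γ n}
    (h : ∀ m m', inner ℂ (gnsWord m) (f (gnsWord m')) = inner ℂ (gnsWord m) (g (gnsWord m')))
    (a b : PreGNS Γ n) : inner ℂ a (f b) = inner ℂ a (g b) := by
  have h1 : ∀ m b, inner ℂ (gnsWord m) (f b) = inner ℂ (gnsWord m) (g b) := fun m =>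
    LinearMap.congr_fun (f := (innerₛₗ ℂ (gnsWord m)) ∘ₗ f) (g := (innerₛₗ ℂ (gnsWord m)) ∘ₗ g)
      (preGNS_ext (h m))
  rw [← inner_conj_symm, ← inner_conj_symm a]
  congr 1
  refine LinearMap.congr_fun (f := innerₛₗ ℂ (f b)) (g := innerₛₗ ℂ (g b)) (preGNS_ext fun m => ?_) a
  have := congrArg conj (h1 m b)
  rwa [inner_conj_symm, inner_conj_symm] at this

/-- Multiplication by a generator. -/
def mulGen (z : Γ × n × n) : PreGNS Γ n →ₗ[ℂ] PreGNS Γ n :=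
  Finsupp.lmapDomain ℂ ℂ (List.cons z)

theorem mulGen_gnsWord (z : Γ × n × n) (m : List (Γ × n × n)) :
    mulGen z (gnsWord m) = gnsWord (z :: m) :=
  Finsupp.mapDomain_single

theorem inner_mulGen_left (z : Γ × n × n) (a b : PreGNS Γ n) :
    inner ℂ (mulGen z a) b = inner ℂ a (mulGen (Duality.dual z.1, z.2) b) := by
  have h1 : ∀ m b, inner ℂ (mulGen z (gnsWord m)) b =
      inner ℂ (gnsWord m) (mulGen (Duality.dual z.1, z.2) b) := fun m =>
    LinearMap.congr_fun (f := innerₛₗ ℂ (mulGen z (gnsWord m)))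
      (g := innerₛₗ ℂ (gnsWord m) ∘ₗ mulGen (Duality.dual z.1, z.2)) (preGNS_ext fun m' => by
        simp only [LinearMap.comp_apply, innerₛₗ_apply_apply, mulGen_gnsWord, inner_gnsWord,
          gnsKernel_cons])
  rw [← inner_conj_symm, ← inner_conj_symm a]
  congr 1
  refine LinearMap.congr_fun (f := innerₛₗ ℂ b ∘ₗ mulGen z)
    (g := innerₛₗ ℂ (mulGen (Duality.dual z.1, z.2) b)) (preGNS_ext fun m => ?_) a
  have := congrArg conj (h1 m b)
  rwa [inner_conj_symm, inner_conj_symm] at this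

theorem inner_sum_mulGen_row (c : Γ) (i j : n) (a b : PreGNS Γ n) :
    inner ℂ a (∑ k, mulGen (c, i, k) (mulGen (Duality.dual c, j, k) b)) =
      inner ℂ a (if i = j then b else 0) := by
  have := inner_ext_word (f := ∑ k, mulGen (c, i, k) ∘ₗ mulGen (Duality.dual c, j, k))
    (g := if i = j then LinearMap.id else 0) (fun m m' => ?_) a b
  · simp only [LinearMap.sum_apply, LinearMap.comp_apply] at this
    rw [this]
    split_ifs <;> simp
  · simp only [LinearMap.sum_apply, LinearMap.comp_apply, mulGen_gnsWord, inner_sum,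
      inner_gnsWord, sum_gnsKernel_row]
    split_ifs <;> simp [inner_gnsWord]

theorem inner_sum_mulGen_col (c : Γ) (i j : n) (a b : PreGNS Γ n) :
    inner ℂ a (∑ k, mulGen (c, k, i) (mulGen (Duality.dual c, k, j) b)) =
      inner ℂ a (if i = j then b else 0) := by
  have := inner_ext_word (f := ∑ k, mulGen (c, k, i) ∘ₗ mulGen (Duality.dual c, k, j))
    (g := if i = j then LinearMap.id else 0) (fun m m' => ?_) a b
  · simp only [LinearMap.sum_apply, LinearMap.comp_apply] at this
    rw [this]
    split_ifs <;> simp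
  · simp only [LinearMap.sum_apply, LinearMap.comp_apply, mulGen_gnsWord, inner_sum,
      inner_gnsWord, sum_gnsKernel_col]
    split_ifs <;> simp [inner_gnsWord]

theorem norm_mulGen_le (z : Γ × n × n) (b : PreGNS Γ n) : ‖mulGen z b‖ ≤ 1 * ‖b‖ := by
  obtain ⟨c, i, j⟩ := z
  -- The column relation gives `∑_k ‖u_{kj} b‖² = ‖b‖²`, which bounds each term.
  have h := inner_sum_mulGen_col (Duality.dual c) j j b b
  rw [if_pos rfl, inner_sum] at h
  simp only [Duality.dual_dual] at h
  have h1 : ∀ k, inner ℂ b (mulGen (Duality.dual c, k, j) (mulGen (c, k, j) b)) =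
      ((‖mulGen (c, k, j) b‖ ^ 2 : ℝ) : ℂ) := fun k => by
    rw [← inner_mulGen_left (c, k, j), inner_self_eq_norm_sq_to_K]
    simp
  simp only [h1, inner_self_eq_norm_sq_to_K] at h
  have h2 : ∑ k, ‖mulGen (c, k, j) b‖ ^ 2 = ‖b‖ ^ 2 := by
    apply Complex.ofReal_injective
    push_cast
    simpa using h
  have h3 := Finset.single_le_sum (f := fun k => ‖mulGen (c, k, j) b‖ ^ 2)
    (fun k _ => sq_nonneg _) (Finset.mem_univ i)
  rw [h2] at h3
  rw [one_mul]
  exact le_of_sq_le_sq h3 (norm_nonneg _)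

/-- The Hilbert space of the vacuum state. -/
abbrev GNS (Γ n : Type) [Duality Γ] [DecidableEq Γ] [DecidableEq n] [Fintype Γ] [Fintype n] :
    Type :=
  UniformSpace.Completion (PreGNS Γ n)

variable (Γ n) in
/-- The generators, acting on the Hilbert space. -/
def gnsGen (c : Γ) : Matrix n n (GNS Γ n →L[ℂ] GNS Γ n) :=
  Matrix.of fun i j => ((mulGen (c, i, j)).mkContinuous 1 (norm_mulGen_le _)).completion

theorem gnsGen_coe (c : Γ) (i j : n) (a : PreGNS Γ n) :
    gnsGen Γ n c i j a = (mulGen (c, i, j) a : PreGNS Γ n) := by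
  simp [gnsGen]

/-- The completion is separated, so null vectors vanish there and the weak identities become
equalities. -/
theorem coe_eq_of_inner {a b : PreGNS Γ n}
    (h : ∀ d : PreGNS Γ n, inner ℂ d a = inner ℂ d b) : (a : GNS Γ n) = b := by
  have h1 : inner ℂ (a - b) (a - b) = 0 := by
    rw [inner_sub_right, h, sub_self]
  have h2 : ‖a - b‖ = 0 := by
    rw [inner_self_eq_norm_sq_to_K] at h1
    exact Complex.ofReal_eq_zero.1 ((pow_eq_zero_iff two_ne_zero).1 h1)
  rw [← sub_eq_zero, ← UniformSpace.Completion.coe_sub, ← norm_eq_zero,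
    UniformSpace.Completion.norm_coe, h2]

theorem gns_coe_sum {A : Type*} (s : Finset A) (f : A → PreGNS Γ n) :
    ((∑ a ∈ s, f a : PreGNS Γ n) : GNS Γ n) = ∑ a ∈ s, (f a : GNS Γ n) :=
  map_sum (UniformSpace.Completion.toCompl : PreGNS Γ n →+ GNS Γ n) f s

theorem gns_ext {f g : GNS Γ n →L[ℂ] GNS Γ n} (h : ∀ a : PreGNS Γ n, f a = g a) : f = g := by
  ext a
  induction a using UniformSpace.Completion.induction_on with
  | hp => exact isClosed_eq f.continuous g.continuous
  | ih a => exact h a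

theorem gnsGen_isColoredUnitary : IsColoredUnitary Duality.dual (gnsGen Γ n) where
  star_apply c i j := by
    rw [ContinuousLinearMap.star_eq_adjoint, eq_comm, ContinuousLinearMap.eq_adjoint_iff]
    intro x y
    induction x, y using UniformSpace.Completion.induction_on₂ with
    | hp => apply isClosed_eq <;> fun_prop
    | ih x y =>
      rw [gnsGen_coe, gnsGen_coe, UniformSpace.Completion.inner_coe,
        UniformSpace.Completion.inner_coe, inner_mulGen_left]
      simp [Duality.dual_dual]
  sum_row c i j := by
    refine gns_ext fun a => ?_
    have := coe_eq_of_inner fun d => inner_sum_mulGen_row c i j d a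
    rw [sum_apply]
    simp only [mul_apply_eq_comp, gnsGen_coe]
    rw [← gns_coe_sum, this]
    split_ifs
    · rfl
    · exact UniformSpace.Completion.coe_zero
  sum_col c i j := by
    refine gns_ext fun a => ?_
    have := coe_eq_of_inner fun d => inner_sum_mulGen_col c i j d a
    rw [sum_apply]
    simp only [mul_apply_eq_comp, gnsGen_coe]
    rw [← gns_coe_sum, this]
    split_ifs
    · rfl
    · exact UniformSpace.Completion.coe_zero

variable (Γ n) in
/-- The vacuum vector. -/
def vacuum : GNS Γ n := (gnsWord [] : PreGNS Γ n)

theorem tensorCoeff_gnsGen_vacuum {x y : List (Γ × n)} (h : x.map Prod.fst = y.map Prod.fst) :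
    ∃ m, rowIndex m = x ∧ colIndex m = y ∧
      tensorCoeff (gnsGen Γ n) x y (vacuum Γ n) = (gnsWord m : PreGNS Γ n) := by
  induction x generalizing y with
  | nil =>
    obtain rfl : y = [] := by simpa using h.symm
    exact ⟨[], rfl, rfl, rfl⟩
  | cons a x ih =>
    match y, h with
    | b :: y, h =>
      obtain ⟨hab, h⟩ := List.cons.inj h
      obtain ⟨m, rfl, rfl, e⟩ := ih h
      refine ⟨(a.1, a.2, b.2) :: m, rfl, ?_, ?_⟩
      · simp [colIndex, hab]
      · rw [tensorCoeff, if_pos hab, mul_apply_eq_comp, e, gnsGen_coe, mulGen_gnsWord]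

/-- Applied to the vacuum, the operator coefficient of index `(x, y)` gives the corresponding word,
so the vacuum state recovers the projection kernel from which the Hilbert space was built. -/
theorem inner_vacuum_tensorCoeff {x y : List (Γ × n)} (h : x.map Prod.fst = y.map Prod.fst) :
    inner ℂ (vacuum Γ n) (tensorCoeff (gnsGen Γ n) x y (vacuum Γ n)) = haar x y := by
  obtain ⟨m, rfl, rfl, e⟩ := tensorCoeff_gnsGen_vacuum h
  rw [e, vacuum, UniformSpace.Completion.inner_coe, inner_gnsWord]
  simp [gnsKernel, rowIndex, colIndex]

theorem inner_vacuum_vacuum : inner ℂ (vacuum Γ n) (vacuum Γ n) = 1 := by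
  rw [vacuum, UniformSpace.Completion.inner_coe, inner_gnsWord]
  simp [gnsKernel, rowIndex, colIndex, haar_nil]

instance : Nontrivial (GNS Γ n) :=
  ⟨vacuum Γ n, 0, fun h => by simpa [h] using inner_vacuum_vacuum (Γ := Γ) (n := n)⟩

end GNS

/-! ### Noncrossing pairings and noncrossing vectors -/

/-- The restriction of `σ` to `{0, …, m - 1}` is a noncrossing pairing. -/
structure IsNCPairing (m : ℕ) (σ : ℕ → ℕ) : Prop where
  lt : ∀ a, a < m → σ a < m
  invol : ∀ a, a < m → σ (σ a) = a
  ne : ∀ a, a < m → σ a ≠ a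
  noncrossing : ∀ a b, a < m → b < m → a < b → b < σ a → ¬ σ a < σ b

/-- The increasing enumeration of the complement of `{p, p + 1}`. -/
def skip (p x : ℕ) : ℕ := if x < p then x else x + 2

theorem skip_lt_skip {p x y : ℕ} : skip p x < skip p y ↔ x < y := by
  unfold skip
  split_ifs <;> omega

theorem skip_injective (p : ℕ) : Function.Injective (skip p) := fun x y h => by
  unfold skip at h
  split_ifs at h <;> omega

theorem skip_ne (p x : ℕ) : skip p x ≠ p ∧ skip p x ≠ p + 1 := by
  unfold skip
  split_ifs <;> omega

theorem skip_lt {p m x : ℕ} (hp : p ≤ m) : skip p x < m + 2 ↔ x < m := by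
  unfold skip
  split_ifs <;> omega

theorem exists_skip_eq {p y : ℕ} (h : y ≠ p) (h' : y ≠ p + 1) : ∃ x, y = skip p x := by
  rcases lt_or_ge y p with hy | hy
  · exact ⟨y, by simp [skip, hy]⟩
  · exact ⟨y - 2, by unfold skip; split_ifs <;> omega⟩

theorem cases_skip (p y : ℕ) : y = p ∨ y = p + 1 ∨ ∃ x, y = skip p x := by
  by_cases h : y = p
  · exact Or.inl h
  · by_cases h' : y = p + 1
    · exact Or.inr (Or.inl h')
    · exact Or.inr (Or.inr (exists_skip_eq h h'))

/-- The pairing `σ` is obtained from `τ` by insertion of a string at the positions `p`, `p + 1`. -/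
structure IsInsertion (p m : ℕ) (σ τ : ℕ → ℕ) : Prop where
  le : p ≤ m
  left : σ p = p + 1
  right : σ (p + 1) = p
  skip : ∀ x, x < m → σ (skip p x) = skip p (τ x)

/-- A string joining neighbors crosses nothing, and `skip p` preserves the order of the remaining
points. -/
theorem IsInsertion.isNCPairing_iff {p m : ℕ} {σ τ : ℕ → ℕ} (h : IsInsertion p m σ τ) :
    IsNCPairing (m + 2) σ ↔ IsNCPairing m τ := by
  constructor
  · intro hσ
    have hlt : ∀ a, a < m → τ a < m := fun a ha => by
      have := hσ.lt _ ((skip_lt h.le).2 ha)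
      rwa [h.skip a ha, skip_lt h.le] at this
    refine ⟨hlt, fun a ha => ?_, fun a ha h' => ?_, fun a b ha hb h1 h2 h3 => ?_⟩
    · have := hσ.invol _ ((skip_lt h.le).2 ha)
      rw [h.skip a ha, h.skip _ (hlt a ha)] at this
      exact skip_injective p this
    · have := hσ.ne _ ((skip_lt h.le).2 ha)
      rw [h.skip a ha, h'] at this
      exact this rfl
    · have := hσ.noncrossing _ _ ((skip_lt h.le).2 ha) ((skip_lt h.le).2 hb)
      rw [h.skip a ha, h.skip b hb, skip_lt_skip, skip_lt_skip, skip_lt_skip] at this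
      exact this h1 h2 h3
  · intro hτ
    have hl := h.left
    have hr := h.right
    have hp := h.le
    refine ⟨fun a ha => ?_, fun a ha => ?_, fun a ha => ?_, fun a b ha hb h1 h2 h3 => ?_⟩
    · rcases cases_skip p a with rfl | rfl | ⟨x, rfl⟩
      · omega
      · omega
      · rw [skip_lt hp] at ha
        rw [h.skip x ha, skip_lt hp]
        exact hτ.lt x ha
    · rcases cases_skip p a with rfl | rfl | ⟨x, rfl⟩
      · rw [hl, hr]
      · rw [hr, hl]
      · rw [skip_lt hp] at ha
        rw [h.skip x ha, h.skip _ (hτ.lt x ha), hτ.invol x ha]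
    · rcases cases_skip p a with rfl | rfl | ⟨x, rfl⟩
      · omega
      · omega
      · rw [skip_lt hp] at ha
        rw [h.skip x ha]
        exact fun e => hτ.ne x ha (skip_injective p e)
    · rcases cases_skip p a with rfl | rfl | ⟨x, rfl⟩
      · omega
      · omega
      · rw [skip_lt hp] at ha
        rw [h.skip x ha] at h2 h3
        rcases cases_skip p b with rfl | rfl | ⟨y, rfl⟩
        · omega
        · omega
        · rw [skip_lt hp] at hb
          rw [h.skip y hb] at h3
          rw [skip_lt_skip] at h1 h2 h3
          exact hτ.noncrossing x y ha hb h1 h2 h3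

/-- The strings of `σ` join letters of `x` exchanged by `g`. -/
def FitsWord {X : Type} (g : X → X) (σ : ℕ → ℕ) (x : List X) : Prop :=
  ∀ a, a < x.length → x[σ a]? = x[a]?.map g

theorem getElem?_skip {X : Type} {p : ℕ} {a : List X} (ha : a.length = p) (s t : X) (b : List X)
    (x : ℕ) : (a ++ s :: t :: b)[skip p x]? = (a ++ b)[x]? := by
  subst ha
  unfold skip
  split_ifs with h
  · rw [List.getElem?_append_left h, List.getElem?_append_left h]
  · rw [List.getElem?_append_right (by omega), List.getElem?_append_right (by omega),
      show x + 2 - a.length = (x - a.length) + 1 + 1 by omega]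
    simp

theorem IsInsertion.fitsWord_iff {X : Type} {g : X → X} (hg : ∀ x, g (g x) = x) {p m : ℕ}
    {σ τ : ℕ → ℕ} (h : IsInsertion p m σ τ) {a b : List X} (ha : a.length = p)
    (hm : a.length + b.length = m) (s t : X) :
    FitsWord g σ (a ++ s :: t :: b) ↔ t = g s ∧ FitsWord g τ (a ++ b) := by
  have hs : (a ++ s :: t :: b)[p]? = some s := by simp [← ha]
  have ht : (a ++ s :: t :: b)[p + 1]? = some t := by simp [← ha]
  constructor
  · intro hx
    refine ⟨?_, fun x hx' => ?_⟩
    · have := hx p (by simp; omega)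
      rw [h.left, hs, ht] at this
      simpa using this
    · have hxm : x < m := by simp at hx'; omega
      have := hx (FreeQG.skip p x) (by
        have := (skip_lt h.le).2 hxm
        simp
        omega)
      rwa [h.skip x hxm, getElem?_skip ha, getElem?_skip ha] at this
  · rintro ⟨rfl, hx⟩ y hy
    rcases cases_skip p y with rfl | rfl | ⟨x, rfl⟩
    · rw [h.left, hs, ht]
      rfl
    · rw [h.right, hs, ht]
      simp [hg]
    · have hxm : x < m := (skip_lt h.le).1 (by simp at hy; omega)
      rw [h.skip x hxm, getElem?_skip ha, getElem?_skip ha]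
      exact hx x (by simp; omega)

section PairingVectors

variable {Γ n : Type} [Duality Γ] [DecidableEq Γ] [DecidableEq n]

open scoped Classical in
/-- The vector given by a pairing of the letters of the color word `w`. -/
def pairingVector (n : Type) (w : List Γ) (σ : ℕ → ℕ) (x : List (Γ × n)) : ℂ :=
  if x.map Prod.fst = w ∧ FitsWord flip σ x then 1 else 0

theorem pairingVector_eq_one {w : List Γ} {σ : ℕ → ℕ} {x : List (Γ × n)}
    (h : x.map Prod.fst = w ∧ FitsWord flip σ x) : pairingVector n w σ x = 1 := if_pos h

theorem pairingVector_eq_zero {w : List Γ} {σ : ℕ → ℕ} {x : List (Γ × n)}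
    (h : ¬ (x.map Prod.fst = w ∧ FitsWord flip σ x)) : pairingVector n w σ x = 0 := if_neg h

theorem pairingVector_nil (σ : ℕ → ℕ) :
    pairingVector n ([] : List Γ) σ = fun x => if x = [] then 1 else 0 := by
  ext x
  by_cases hx : x = []
  · simp [pairingVector, hx, FitsWord]
  · simp [pairingVector, hx]

/-- The bridge between the two descriptions: adding a string between neighbors to a pairing is `cup`
on its vector. -/
theorem IsInsertion.pairingVector_eq {p m : ℕ} {σ τ : ℕ → ℕ} (h : IsInsertion p m σ τ)
    {a b : List Γ} (ha : a.length = p) (hm : a.length + b.length = m) (c : Γ) :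
    pairingVector n (a ++ c :: Duality.dual c :: b) σ =
      cup a.length c (pairingVector n (a ++ b) τ) := by
  have h1 : ∀ w σ, SupportedOn w.length (pairingVector (Γ := Γ) n w σ) := fun w σ x hx =>
    if_neg fun h => hx (by rw [← h.1]; simp)
  refine SupportedOn.ext (h1 _ σ) (by
    convert (h1 (a ++ b) τ).cup c using 1
    simp; omega) fun x hx => ?_
  obtain ⟨y, s, t, z, rfl, hy, hz⟩ :=
    exists_append_two (x := x) (p := a.length) (q := b.length) (by simp at hx; omega)
  have h3 := h.fitsWord_iff flip_flip (hy.trans ha) (b := z) (by omega) s t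
  rw [cup_append hy]
  have h2 : (y ++ s :: t :: z).map Prod.fst = a ++ c :: Duality.dual c :: b ↔
      (y ++ z).map Prod.fst = a ++ b ∧ s.1 = c ∧ t.1 = Duality.dual c := by
    simp only [List.map_append, List.map_cons]
    constructor
    · intro h
      obtain ⟨h1, h2⟩ := List.append_inj h (by simpa using hy)
      simp only [List.cons.injEq] at h2
      exact ⟨by rw [h1, h2.2.2], h2.1, h2.2.1⟩
    · rintro ⟨h, rfl, h'⟩
      obtain ⟨h1, h2⟩ := List.append_inj h (by simpa using hy)
      rw [h1, h2, h']
  by_cases hc : s.1 = c ∧ t = flip s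
  · rw [if_pos hc]
    by_cases hv : (y ++ z).map Prod.fst = a ++ b ∧ FitsWord flip τ (y ++ z)
    · rw [pairingVector_eq_one hv, pairingVector_eq_one ⟨h2.2 ⟨hv.1, hc.1, ?_⟩, h3.2 ⟨hc.2, hv.2⟩⟩]
      rw [hc.2, ← hc.1]
      rfl
    · rw [pairingVector_eq_zero hv,
        pairingVector_eq_zero fun h => hv ⟨(h2.1 h.1).1, (h3.1 h.2).2⟩]
  · rw [if_neg hc, pairingVector_eq_zero fun h => hc ⟨(h2.1 h.1).2.1, (h3.1 h.2).1⟩]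

theorem IsNCPairing.exists_adjacent {m : ℕ} {σ : ℕ → ℕ} (hσ : IsNCPairing m σ) (hm : 0 < m) :
    ∃ p, p + 1 < m ∧ σ p = p + 1 := by
  -- Descent on the length of a string: if `a` is not joined to `a + 1`, noncrossing forces the
  -- string at `a + 1` to be nested strictly inside that of `a`.
  have key : ∀ d a, a < m → a < σ a → σ a - a ≤ d → ∃ p, p + 1 < m ∧ σ p = p + 1 := by
    intro d
    induction d with
    | zero => intro a _ _ _; omega
    | succ d ih =>
      intro a ha h1 h2
      have hlt := hσ.lt a ha
      by_cases h3 : σ a = a + 1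
      · exact ⟨a, by omega, h3⟩
      · have hb : a + 1 < m := by omega
        have h4 := hσ.noncrossing a (a + 1) ha hb (by omega) (by omega)
        have h5 := hσ.invol a ha
        have h6 := hσ.invol (a + 1) hb
        have h7 := hσ.lt (a + 1) hb
        have h8 := hσ.ne (a + 1) hb
        have h9 : σ (a + 1) ≠ σ a := fun e => by rw [e, h5] at h6; omega
        have h10 : σ (a + 1) ≠ a := fun e => by rw [e] at h6; omega
        -- Rules out a partner of `a + 1` to the left of `a`; `h4` rules out one beyond `σ a`.
        have h11 := hσ.noncrossing (σ (a + 1)) a h7 ha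
        rw [h6] at h11
        exact ih (a + 1) hb (by omega) (by omega)
  rcases lt_or_gt_of_ne (hσ.ne 0 hm) with h | h
  · omega
  · exact key _ 0 hm h le_rfl

theorem IsNCPairing.exists_isInsertion {m : ℕ} {σ : ℕ → ℕ} (hσ : IsNCPairing (m + 2) σ) {p : ℕ}
    (hp : p ≤ m) (h : σ p = p + 1) : ∃ τ, IsInsertion p m σ τ := by
  have h' : σ (p + 1) = p := by rw [← h, hσ.invol p (by omega)]
  have : ∀ x, ∃ y, x < m → σ (skip p x) = skip p y := fun x => by
    by_cases hx : x < m
    · have hx' := (skip_lt hp).2 hx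
      have h1 := hσ.invol _ hx'
      have h2 := skip_ne p x
      obtain ⟨y, hy⟩ := exists_skip_eq (p := p) (y := σ (skip p x))
        (fun e => by rw [e, h] at h1; omega) (fun e => by rw [e, h'] at h1; omega)
      exact ⟨y, fun _ => hy⟩
    · exact ⟨0, fun h => absurd h hx⟩
  choose τ hτ using this
  exact ⟨τ, hp, h, h', hτ⟩

theorem exists_isInsertion {m p : ℕ} (hp : p ≤ m) (τ : ℕ → ℕ) : ∃ σ, IsInsertion p m σ τ := by
  refine ⟨fun y => if y = p then p + 1 else if y = p + 1 then p else
    skip p (τ (if y < p then y else y - 2)), hp, by simp, by simp, fun x _ => ?_⟩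
  have h := skip_ne p x
  simp only [h.1, h.2, if_false]
  congr 2
  unfold skip
  split_ifs <;> omega

/-- Remove a string joining neighbors and induct; reinserting it is a cup. The fitting condition on
colors says that this cup has dual colors at its ends. -/
theorem IsNCPairing.isNC {m : ℕ} {σ : ℕ → ℕ} (hσ : IsNCPairing m σ) {w : List Γ}
    (hm : w.length = m) (hw : FitsWord Duality.dual σ w) : IsNC w (pairingVector n w σ) := by
  induction m using Nat.strong_induction_on generalizing σ w with
  | _ m ih =>
    rcases Nat.eq_zero_or_pos m with rfl | h0
    · obtain rfl := List.length_eq_zero_iff.1 hm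
      rw [pairingVector_nil]
      exact IsNC.nil
    · obtain ⟨p, hp, h⟩ := hσ.exists_adjacent h0
      obtain ⟨m, rfl⟩ : ∃ k, m = k + 2 := ⟨m - 2, by omega⟩
      obtain ⟨τ, hτ⟩ := hσ.exists_isInsertion (p := p) (by omega) h
      obtain ⟨a, s, t, b, rfl, ha, hb⟩ :=
        exists_append_two (x := w) (p := p) (q := m - p) (by omega)
      obtain ⟨rfl, hwτ⟩ := (hτ.fitsWord_iff Duality.dual_dual ha (by omega) s t).1 hw
      rw [hτ.pairingVector_eq ha (by omega)]
      exact IsNC.cup a b s _ (ih m (by omega) (hτ.isNCPairing_iff.1 hσ) (by simp; omega) hwτ)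

theorem IsNC.exists_pairing {w : List Γ} {f : List (Γ × n) → ℂ} (hf : IsNC w f) :
    ∃ σ, IsNCPairing w.length σ ∧ FitsWord Duality.dual σ w ∧ f = pairingVector n w σ := by
  induction hf with
  | nil =>
    exact ⟨id, ⟨by simp, by simp, by simp, by simp⟩, fun a h => by simp at h,
      (pairingVector_nil id).symm⟩
  | cup a b c f hf ih =>
    obtain ⟨τ, h1, h2, rfl⟩ := ih
    obtain ⟨σ, hσ⟩ := exists_isInsertion (m := a.length + b.length) (p := a.length) (by omega) τ
    refine ⟨σ, ?_, (hσ.fitsWord_iff Duality.dual_dual rfl rfl _ _).2 ⟨rfl, h2⟩,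
      (hσ.pairingVector_eq rfl rfl c).symm⟩
    rw [List.length_append] at h1
    convert hσ.isNCPairing_iff.2 h1 using 1
    simp; omega

end PairingVectors

/-! ### Pairings between two rows -/

section Position

variable {p q : ℕ}

theorem position_lt (s : Fin p ⊕ Fin q) : position s < p + q := by
  rcases s with a | b <;> simp only [position] <;> omega

theorem position_injective : Function.Injective (position : Fin p ⊕ Fin q → ℕ) := by
  rintro (a | a) (b | b) h <;> simp only [position] at h
  · exact congrArg _ (Fin.ext h)
  · omega
  · omega
  · exact congrArg _ (Fin.rev_injective (Fin.ext (by omega)))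

theorem exists_position {x : ℕ} (hx : x < p + q) : ∃ s : Fin p ⊕ Fin q, position s = x := by
  by_cases h : x < p
  · exact ⟨.inl ⟨x, h⟩, rfl⟩
  · refine ⟨.inr (Fin.rev ⟨x - p, by omega⟩), ?_⟩
    simp only [position, Fin.rev_rev]
    omega

/-- `σ` is the pairing `π`, the points being numbered by their positions around the two rows. -/
def Pairing.Encodes (π : Pairing p q) (σ : ℕ → ℕ) : Prop :=
  ∀ s, σ (position s) = position (π.partner s)

theorem Pairing.exists_encodes (π : Pairing p q) : ∃ σ, π.Encodes σ := by
  classical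
  refine ⟨fun x => if h : ∃ s : Fin p ⊕ Fin q, position s = x then
    position (π.partner h.choose) else x, fun s => ?_⟩
  have h : ∃ t : Fin p ⊕ Fin q, position t = position s := ⟨s, rfl⟩
  simp only [h, dif_pos]
  rw [position_injective h.choose_spec]

theorem IsNCPairing.exists_encodes {σ : ℕ → ℕ} (hσ : IsNCPairing (p + q) σ) :
    ∃ π : Pairing p q, π.Encodes σ := by
  choose f hf using fun s : Fin p ⊕ Fin q => exists_position (hσ.lt _ (position_lt s))
  refine ⟨⟨f, fun s => position_injective ?_, fun s h => ?_⟩, fun s => (hf s).symm⟩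
  · rw [hf, hf, hσ.invol _ (position_lt s)]
  · have := hf s
    rw [h] at this
    exact hσ.ne _ (position_lt s) this.symm

theorem Pairing.Encodes.isNCPairing_iff {π : Pairing p q} {σ : ℕ → ℕ} (h : π.Encodes σ) :
    IsNCPairing (p + q) σ ↔ π.IsNoncrossing := by
  constructor
  · rintro hσ ⟨s, t, h1, h2, h3⟩
    rw [← h, ← h] at h3
    rw [← h] at h2
    exact hσ.noncrossing _ _ (position_lt s) (position_lt t) h1 h2 h3
  · intro hπ
    refine ⟨fun a ha => ?_, fun a ha => ?_, fun a ha => ?_, fun a b ha hb h1 h2 h3 => ?_⟩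
    · obtain ⟨s, rfl⟩ := exists_position ha
      rw [h s]
      exact position_lt _
    · obtain ⟨s, rfl⟩ := exists_position ha
      rw [h s, h, π.partner_partner]
    · obtain ⟨s, rfl⟩ := exists_position ha
      rw [h s]
      exact fun e => π.partner_ne s (position_injective e)
    · obtain ⟨s, rfl⟩ := exists_position ha
      obtain ⟨t, rfl⟩ := exists_position hb
      rw [h s] at h2 h3
      rw [h t] at h3
      exact hπ ⟨s, t, h1, h2, h3⟩

/-- The list of the labels of the points of two rows, ordered by position. -/
def rowsWord {X : Type} (a : Fin p → X) (b : Fin q → X) : List X :=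
  List.ofFn a ++ (List.ofFn b).reverse

theorem length_rowsWord {X : Type} (a : Fin p → X) (b : Fin q → X) :
    (rowsWord a b).length = p + q := by
  simp [rowsWord]

theorem getElem?_rowsWord {X : Type} (a : Fin p → X) (b : Fin q → X) (s : Fin p ⊕ Fin q) :
    (rowsWord a b)[position s]? = some (Sum.elim a b s) := by
  rcases s with x | x
  · rw [rowsWord, position, List.getElem?_append_left (by simp)]
    simp
  · have hx := x.2
    rw [rowsWord, position, List.getElem?_append_right (by simp)]
    rw [List.length_ofFn, Nat.add_sub_cancel_left, List.getElem?_reverse (by simp; omega),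
      List.length_ofFn, Fin.val_rev, show q - 1 - (q - (x + 1)) = x by omega]
    simp

theorem Pairing.Encodes.fitsWord_iff {π : Pairing p q} {σ : ℕ → ℕ} (h : π.Encodes σ) {X : Type}
    (g : X → X) (a : Fin p → X) (b : Fin q → X) :
    FitsWord g σ (rowsWord a b) ↔ ∀ s, Sum.elim a b (π.partner s) = g (Sum.elim a b s) := by
  constructor
  · intro hx s
    have := hx (position s) (by rw [length_rowsWord]; exact position_lt s)
    rw [h s, getElem?_rowsWord, getElem?_rowsWord] at this
    simpa using this
  · intro hx x hx'
    rw [length_rowsWord] at hx'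
    obtain ⟨s, rfl⟩ := exists_position hx'
    rw [h s, getElem?_rowsWord, getElem?_rowsWord, hx s]
    rfl

end Position

/-! ### Bending the lower row: matrices as vectors -/

section Bend

variable {Γ n : Type} [Duality Γ] {p q : ℕ}

/-- The colored multi-index of an entry of a tensor power. -/
def letters (k : Fin p → Γ) (i : Fin p → n) : List (Γ × n) := List.ofFn fun a => (k a, i a)

/-- The word obtained by reading an upper row, and then the conjugate of a lower row. -/
def bend (k : Fin p → Γ) (l : Fin q → Γ) (i : Fin p → n) (j : Fin q → n) : List (Γ × n) :=
  letters k i ++ conjWord (letters l j)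

/-- The color word of `bend k l i j`. -/
def colorWord (k : Fin p → Γ) (l : Fin q → Γ) : List Γ := rowsWord k fun b => Duality.dual (l b)

theorem bend_eq_rowsWord (k : Fin p → Γ) (l : Fin q → Γ) (i : Fin p → n) (j : Fin q → n) :
    bend k l i j = rowsWord (fun a => (k a, i a)) fun b => (Duality.dual (l b), j b) := by
  simp [bend, letters, conjWord, rowsWord, List.map_ofFn, Function.comp_def, flip]

theorem map_fst_letters (k : Fin p → Γ) (i : Fin p → n) :
    (letters k i).map Prod.fst = List.ofFn k := by
  simp [letters, List.map_ofFn, Function.comp_def]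

theorem map_fst_bend (k : Fin p → Γ) (l : Fin q → Γ) (i : Fin p → n) (j : Fin q → n) :
    (bend k l i j).map Prod.fst = colorWord k l := by
  simp [bend_eq_rowsWord, colorWord, rowsWord, List.map_ofFn, Function.comp_def]

theorem length_colorWord (k : Fin p → Γ) (l : Fin q → Γ) : (colorWord k l).length = p + q :=
  length_rowsWord _ _

theorem length_letters (k : Fin p → Γ) (i : Fin p → n) : (letters k i).length = p := by
  simp [letters]

theorem length_bend (k : Fin p → Γ) (l : Fin q → Γ) (i : Fin p → n) (j : Fin q → n) :
    (bend k l i j).length = p + q := by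
  simp [bend, length_letters]

/-- The color of a point, the colors of the lower row being conjugated. -/
def pointColor (k : Fin p → Γ) (l : Fin q → Γ) : Fin p ⊕ Fin q → Γ :=
  Sum.elim k fun b => Duality.dual (l b)

/-- The strings of `π` join dual colors, the colors of the lower row being conjugated. -/
def Pairing.JoinsDual (π : Pairing p q) (k : Fin p → Γ) (l : Fin q → Γ) : Prop :=
  ∀ s, pointColor k l (π.partner s) = Duality.dual (pointColor k l s)

theorem Pairing.Encodes.fitsWord_colorWord_iff {π : Pairing p q} {σ : ℕ → ℕ} (h : π.Encodes σ)
    (k : Fin p → Γ) (l : Fin q → Γ) :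
    FitsWord Duality.dual σ (colorWord k l) ↔ π.JoinsDual k l :=
  h.fitsWord_iff _ _ _

/-- Once the strings join dual colors, the color half of the fitting condition is automatic and only
equality of indices remains. -/
theorem Pairing.Encodes.fitsWord_bend_iff {π : Pairing p q} {σ : ℕ → ℕ} (h : π.Encodes σ)
    {k : Fin p → Γ} {l : Fin q → Γ} (hπ : π.JoinsDual k l) (i : Fin p → n) (j : Fin q → n) :
    FitsWord flip σ (bend k l i j) ↔ π.Fits i j := by
  rw [bend_eq_rowsWord, h.fitsWord_iff]
  have key : ∀ s, Sum.elim (fun a => (k a, i a)) (fun b => (Duality.dual (l b), j b)) s =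
      (pointColor k l s, Sum.elim i j s) := by
    rintro (a | b) <;> rfl
  simp only [key, flip, hπ _, Prod.mk.injEq, true_and]
  rfl

variable [DecidableEq Γ] [DecidableEq n]

/-- The matrix given by a function on words. -/
def unbend (n : Type) (k : Fin p → Γ) (l : Fin q → Γ) :
    (List (Γ × n) → ℂ) →ₗ[ℂ] Matrix (Fin p → n) (Fin q → n) ℂ where
  toFun f := Matrix.of fun i j => f (bend k l i j)
  map_add' _ _ := rfl
  map_smul' _ _ := rfl

theorem unbend_apply (k : Fin p → Γ) (l : Fin q → Γ) (f : List (Γ × n) → ℂ) (i : Fin p → n)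
    (j : Fin q → n) : unbend n k l f i j = f (bend k l i j) := rfl

theorem unbend_pairingVector {N : ℕ} {π : Pairing p q} {σ : ℕ → ℕ} (h : π.Encodes σ)
    {k : Fin p → Γ} {l : Fin q → Γ} (hπ : π.JoinsDual k l) :
    unbend (Fin N) k l (pairingVector (Fin N) (colorWord k l) σ) = (π.T N)ᴴ := by
  ext i j
  rw [unbend_apply, Matrix.conjTranspose_apply, Pairing.T, Matrix.of_apply]
  by_cases hf : π.Fits i j
  · rw [pairingVector_eq_one ⟨map_fst_bend k l i j, (h.fitsWord_bend_iff hπ i j).2 hf⟩, if_pos hf, star_one]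
  · rw [pairingVector_eq_zero fun h' => hf ((h.fitsWord_bend_iff hπ i j).1 h'.2), if_neg hf, star_zero]

theorem IsNC.exists_unbend_eq {N : ℕ} {k : Fin p → Γ} {l : Fin q → Γ}
    {f : List (Γ × Fin N) → ℂ} (hf : IsNC (colorWord k l) f) :
    ∃ π : Pairing p q, π.IsNoncrossing ∧ π.JoinsDual k l ∧ unbend (Fin N) k l f = (π.T N)ᴴ := by
  obtain ⟨σ, hσ, hw, rfl⟩ := hf.exists_pairing
  rw [length_colorWord] at hσ
  obtain ⟨π, hπ⟩ := hσ.exists_encodes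
  have hd := (hπ.fitsWord_colorWord_iff k l).1 hw
  exact ⟨π, hπ.isNCPairing_iff.1 hσ, hd, unbend_pairingVector hπ hd⟩

theorem Pairing.IsNoncrossing.exists_isNC {π : Pairing p q} (hπ : π.IsNoncrossing)
    {k : Fin p → Γ} {l : Fin q → Γ} (hd : π.JoinsDual k l) (N : ℕ) :
    ∃ f : List (Γ × Fin N) → ℂ, IsNC (colorWord k l) f ∧ unbend (Fin N) k l f = (π.T N)ᴴ := by
  obtain ⟨σ, hσ⟩ := π.exists_encodes
  exact ⟨_, (hσ.isNCPairing_iff.2 hπ).isNC (length_colorWord k l)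
    ((hσ.fitsWord_colorWord_iff k l).2 hd), unbend_pairingVector hσ hd⟩

end Bend

/-! ### Coefficients of the tensor powers -/

section TensorCoeff

theorem tensorCoeff_cons {Γ n B : Type*} [DecidableEq Γ] [Ring B] (v : Γ → Matrix n n B)
    (a b : Γ × n) (x y : List (Γ × n)) : tensorCoeff v (a :: x) (b :: y) =
      (if a.1 = b.1 then v a.1 a.2 b.2 else 0) * tensorCoeff v x y := rfl

theorem tensorCoeff_nil {Γ n B : Type*} [DecidableEq Γ] [Ring B] (v : Γ → Matrix n n B) :
    tensorCoeff v [] [] = 1 := rfl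

variable {Γ n : Type} {B : Type*} [Duality Γ] [DecidableEq Γ] [DecidableEq n] [Fintype Γ]
  [Fintype n] [Ring B] {v : Γ → Matrix n n B}

theorem tensorCoeff_append {x y : List (Γ × n)} (h : x.length = y.length) (x' y' : List (Γ × n)) :
    tensorCoeff v (x ++ x') (y ++ y') = tensorCoeff v x y * tensorCoeff v x' y' := by
  induction x generalizing y with
  | nil =>
    obtain rfl := List.length_eq_zero_iff.1 h.symm
    simp [tensorCoeff_nil]
  | cons a x ih =>
    match y, h with
    | b :: y, h =>
      rw [List.cons_append, List.cons_append, tensorCoeff_cons, tensorCoeff_cons,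
        ih (by simpa using h), mul_assoc]

theorem map_fst_eq_of_tensorCoeff_ne_zero {x y : List (Γ × n)} (h : x.length = y.length)
    (hv : tensorCoeff v x y ≠ 0) : x.map Prod.fst = y.map Prod.fst := by
  induction x generalizing y with
  | nil =>
    obtain rfl := List.length_eq_zero_iff.1 h.symm
    rfl
  | cons a x ih =>
    match y, h with
    | b :: y, h =>
      rw [tensorCoeff_cons] at hv
      have h1 : a.1 = b.1 := by
        by_contra h1
        simp [h1] at hv
      rw [List.map_cons, List.map_cons, h1, ih (by simpa using h) (right_ne_zero_of_mul hv)]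

theorem map_tensorCoeff {C : Type*} [Ring C] {F : Type*} [FunLike F B C] [RingHomClass F B C]
    (φ : F) {w : Γ → Matrix n n C} (h : ∀ c i j, φ (v c i j) = w c i j) {x y : List (Γ × n)}
    (hxy : x.length = y.length) : φ (tensorCoeff v x y) = tensorCoeff w x y := by
  induction x generalizing y with
  | nil =>
    obtain rfl := List.length_eq_zero_iff.1 hxy.symm
    simp [tensorCoeff_nil]
  | cons a x ih =>
    match y, hxy with
    | b :: y, hxy =>
      rw [tensorCoeff_cons, tensorCoeff_cons, map_mul, ih (by simpa using hxy), apply_ite φ,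
        map_zero, h]

variable [StarRing B]

theorem star_tensorCoeff (hv : IsColoredUnitary Duality.dual v) {x y : List (Γ × n)}
    (h : x.length = y.length) :
    star (tensorCoeff v x y) = tensorCoeff v (conjWord x) (conjWord y) := by
  induction x generalizing y with
  | nil =>
    obtain rfl := List.length_eq_zero_iff.1 h.symm
    simp [tensorCoeff_nil]
  | cons a x ih =>
    match y, h with
    | b :: y, h =>
      have h' : x.length = y.length := by simpa using h
      rw [tensorCoeff_cons, star_mul, ih h', conjWord_cons, conjWord_cons,
        tensorCoeff_append (by simp [h']), tensorCoeff_cons, tensorCoeff_nil, mul_one]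
      congr 1
      have : (flip a).1 = (flip b).1 ↔ a.1 = b.1 :=
        ⟨fun e => by simpa [flip, Duality.dual_dual] using congrArg Duality.dual e,
          fun e => by simp [flip, e]⟩
      by_cases hab : a.1 = b.1
      · rw [if_pos hab, if_pos (this.2 hab), hv.star_apply]
        rfl
      · rw [if_neg hab, if_neg (fun e => hab (this.1 e)), star_zero]

theorem sum_letter_mul_star (hv : IsColoredUnitary Duality.dual v) (a a' : Γ × n) :
    ∑ b : Γ × n, (if a.1 = b.1 then v a.1 a.2 b.2 else 0) *
      star (if a'.1 = b.1 then v a'.1 a'.2 b.2 else 0) = if a = a' then 1 else 0 := by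
  obtain ⟨c, i⟩ := a
  obtain ⟨c', i'⟩ := a'
  rw [Fintype.sum_prod_type, Finset.sum_eq_single c]
  · by_cases h : c' = c
    · subst h
      simp [hv.star_apply, hv.sum_row]
    · have h' : c ≠ c' := fun e => h e.symm
      simp [h, h']
  · intro d _ hd
    simp [hd.symm]
  · simp

theorem sum_star_mul_letter (hv : IsColoredUnitary Duality.dual v) (a a' : Γ × n) :
    ∑ b : Γ × n, star (if b.1 = a.1 then v b.1 b.2 a.2 else 0) *
      (if b.1 = a'.1 then v b.1 b.2 a'.2 else 0) = if a = a' then 1 else 0 := by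
  obtain ⟨c, i⟩ := a
  obtain ⟨c', i'⟩ := a'
  rw [Fintype.sum_prod_type, Finset.sum_eq_single c]
  · by_cases h : c = c'
    · subst h
      have := hv.sum_col (Duality.dual c) i i'
      rw [Duality.dual_dual] at this
      simp [hv.star_apply, this]
    · simp [h]
  · intro d _ hd
    simp [hd]
  · simp

/-- The star reverses the order, so the tails meet in the middle: the sum collapses from the last
letter outwards. In `sum_star_mul_tensorCoeff` the first letters meet instead, whence the exchange
of sums there. -/
theorem sum_tensorCoeff_mul_star (hv : IsColoredUnitary Duality.dual v) {x x' : List (Γ × n)}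
    {m : ℕ} (hx : x.length = m) (hx' : x'.length = m) :
    ∑ y ∈ words (Γ × n) m, tensorCoeff v x y * star (tensorCoeff v x' y) =
      if x = x' then 1 else 0 := by
  induction m generalizing x x' with
  | zero =>
    simp [sum_words_zero, List.length_eq_zero_iff.1 hx, List.length_eq_zero_iff.1 hx',
      tensorCoeff_nil]
  | succ m ih =>
    match x, x', hx, hx' with
    | a :: x, a' :: x', hx, hx' =>
      have e := ih (x := x) (x' := x') (by simpa using hx) (by simpa using hx')
      have e' := sum_letter_mul_star hv a a'
      simp only [sum_words_succ, tensorCoeff_cons, star_mul]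
      have : ∀ b : Γ × n, ∀ y, (if a.1 = b.1 then v a.1 a.2 b.2 else 0) * tensorCoeff v x y *
          (star (tensorCoeff v x' y) * star (if a'.1 = b.1 then v a'.1 a'.2 b.2 else 0)) =
          (if a.1 = b.1 then v a.1 a.2 b.2 else 0) *
            ((tensorCoeff v x y * star (tensorCoeff v x' y)) *
              star (if a'.1 = b.1 then v a'.1 a'.2 b.2 else 0)) := fun b y => by
        simp only [mul_assoc]
      simp only [this, ← Finset.mul_sum, ← Finset.sum_mul, e]
      by_cases h : x = x'
      · simp only [h, if_true, one_mul, e', List.cons.injEq, and_true]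
      · simp [h]

theorem sum_star_mul_tensorCoeff (hv : IsColoredUnitary Duality.dual v) {x x' : List (Γ × n)}
    {m : ℕ} (hx : x.length = m) (hx' : x'.length = m) :
    ∑ y ∈ words (Γ × n) m, star (tensorCoeff v y x) * tensorCoeff v y x' =
      if x = x' then 1 else 0 := by
  induction m generalizing x x' with
  | zero =>
    simp [sum_words_zero, List.length_eq_zero_iff.1 hx, List.length_eq_zero_iff.1 hx',
      tensorCoeff_nil]
  | succ m ih =>
    match x, x', hx, hx' with
    | a :: x, a' :: x', hx, hx' =>
      have e := ih (x := x) (x' := x') (by simpa using hx) (by simpa using hx')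
      have e' := sum_star_mul_letter hv a a'
      simp only [sum_words_succ, tensorCoeff_cons, star_mul]
      rw [Finset.sum_comm]
      have : ∀ b : Γ × n, ∀ y, star (tensorCoeff v y x) *
          star (if b.1 = a.1 then v b.1 b.2 a.2 else 0) *
          ((if b.1 = a'.1 then v b.1 b.2 a'.2 else 0) * tensorCoeff v y x') =
          star (tensorCoeff v y x) * ((star (if b.1 = a.1 then v b.1 b.2 a.2 else 0) *
            (if b.1 = a'.1 then v b.1 b.2 a'.2 else 0)) * tensorCoeff v y x') := fun b y => by
        simp only [mul_assoc]
      simp only [this, ← Finset.mul_sum, ← Finset.sum_mul, e']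
      by_cases h : a = a'
      · simp only [h, if_true, one_mul, e, List.cons.injEq, true_and]
      · simp [h]

end TensorCoeff

/-! ### Sums over words with prescribed colors -/

section SumLetters

variable {Γ n : Type} [Duality Γ] [DecidableEq Γ] [DecidableEq n] [Fintype Γ] [Fintype n]
  {M : Type*} [AddCommMonoid M] {p q : ℕ}

theorem letters_injective (k : Fin p → Γ) :
    Function.Injective (letters k : (Fin p → n) → List (Γ × n)) := fun i i' h => by
  have := List.ofFn_injective h
  ext a
  exact (Prod.mk.inj (congrFun this a)).2

theorem exists_letters_eq {k : Fin p → Γ} {y : List (Γ × n)}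
    (hy : y.map Prod.fst = List.ofFn k) : ∃ i, letters k i = y := by
  have hl : y.length = p := by simpa using congrArg List.length hy
  subst hl
  refine ⟨fun a => (y.get a).2, ?_⟩
  have hk : ∀ a, k a = (y.get a).1 := fun a => by
    have h1 : (List.ofFn k)[(a : ℕ)]? = some (k a) := by simp
    rw [← hy] at h1
    simpa using h1.symm
  simp only [letters, hk]
  exact List.ofFn_get y

theorem sum_words_eq_sum_letters (k : Fin p → Γ) (F : List (Γ × n) → M)
    (hF : ∀ y, y.length = p → F y ≠ 0 → y.map Prod.fst = List.ofFn k) :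
    ∑ y ∈ words (Γ × n) p, F y = ∑ i, F (letters k i) := by
  symm
  refine Finset.sum_of_injOn (letters k) (letters_injective k).injOn
    (fun i _ => mem_words.2 (length_letters k i)) (fun y hl hy => ?_) fun _ _ => rfl
  by_contra h
  obtain ⟨i, rfl⟩ := exists_letters_eq (hF y (mem_words.1 hl) h)
  exact hy ⟨i, Finset.mem_coe.2 (Finset.mem_univ i), rfl⟩

theorem sum_words_eq_sum_bend (k : Fin p → Γ) (l : Fin q → Γ) (F : List (Γ × n) → M)
    (hF : ∀ y, F y ≠ 0 → y.map Prod.fst = colorWord k l) :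
    ∑ y ∈ words (Γ × n) (p + q), F y = ∑ i, ∑ j, F (bend k l i j) := by
  have key : ∀ y z, F (y ++ conjWord z) ≠ 0 → y.length = p →
      y.map Prod.fst = List.ofFn k ∧ z.map Prod.fst = List.ofFn l := by
    intro y z h hy
    have := hF _ h
    rw [List.map_append, colorWord, rowsWord] at this
    obtain ⟨h1, h2⟩ := List.append_inj this (by simp [hy])
    refine ⟨h1, ?_⟩
    rw [conjWord, List.map_reverse, List.reverse_inj, List.map_map] at h2
    have h3 := congrArg (List.map Duality.dual) h2
    simpa [List.map_ofFn, Function.comp_def, flip, Duality.dual_dual] using h3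
  rw [sum_words_add, sum_words_eq_sum_letters k]
  · refine Finset.sum_congr rfl fun i _ => ?_
    rw [← sum_words_conj, sum_words_eq_sum_letters l]
    · rfl
    · exact fun z _ hz => (key _ z hz (length_letters k i)).2
  · intro y hy h
    obtain ⟨z, -, hz⟩ := Finset.exists_ne_zero_of_sum_ne_zero h
    rw [← conjWord_conjWord z] at hz
    exact (key y _ hz hy).1

end SumLetters

/-! ### Intertwiners as fixed vectors -/

section Fixed

variable {Γ n : Type} {B : Type*} [Duality Γ] [DecidableEq Γ] [DecidableEq n] [Fintype Γ]
  [Fintype n] [Ring B] [StarRing B] [Algebra ℂ B] {v : Γ → Matrix n n B}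

theorem sum_letter_cup (hv : IsColoredUnitary Duality.dual v) (s t : Γ × n) (c : Γ) :
    ∑ i, (if s.1 = c then v s.1 s.2 i else 0) *
      (if t.1 = Duality.dual c then v t.1 t.2 i else 0) =
      if s.1 = c ∧ t = flip s then 1 else 0 := by
  obtain ⟨d, j⟩ := s
  obtain ⟨e, k⟩ := t
  by_cases hd : d = c
  · subst hd
    by_cases he : e = Duality.dual d
    · subst he
      simp [hv.sum_row, flip, eq_comm]
    · simp [he, flip]
  · simp [hd]

/-- The noncrossing vectors are fixed by the tensor powers. -/
theorem IsNC.sum_smul_tensorCoeff (hv : IsColoredUnitary Duality.dual v) {w : List Γ}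
    {f : List (Γ × n) → ℂ} (hf : IsNC w f) {x : List (Γ × n)} (hx : x.length = w.length) :
    ∑ y ∈ words (Γ × n) w.length, f y • tensorCoeff v x y = f x • 1 := by
  induction hf generalizing x with
  | nil =>
    rw [List.length_nil, sum_words_zero, List.length_eq_zero_iff.1 hx, tensorCoeff_nil]
  | cup a b c f hf ih =>
    obtain ⟨x, s, t, z, rfl, hx, hz⟩ :=
      exists_append_two (x := x) (p := a.length) (q := b.length) (by simp at hx; omega)
    rw [cup_append hx, List.length_append, List.length_cons, List.length_cons, add_assoc,
      sum_cup_smul]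
    have key : ∀ y ∈ words (Γ × n) a.length, ∀ u ∈ words (Γ × n) b.length,
        f (y ++ u) • ∑ i, tensorCoeff v (x ++ s :: t :: z)
          (y ++ (c, i) :: (Duality.dual c, i) :: u) =
        if s.1 = c ∧ t = flip s then f (y ++ u) • tensorCoeff v (x ++ z) (y ++ u) else 0 := by
      intro y hy u hu
      rw [mem_words] at hy
      have h1 := sum_letter_cup hv s t c
      have h2 : x.length = y.length := by omega
      simp only [tensorCoeff_append h2, tensorCoeff_cons, ← Finset.mul_sum]
      simp only [← mul_assoc, ← Finset.sum_mul]
      simp only [mul_assoc] at h1 ⊢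
      rw [h1]
      split_ifs <;> simp
    rw [Finset.sum_congr rfl fun y hy => Finset.sum_congr rfl fun u hu => key y hy u hu]
    split_ifs with hc
    · rw [← sum_words_add a.length b.length fun y => f y • tensorCoeff v (x ++ z) y,
        ← List.length_append, ih (by simp; omega)]
    · simp

variable {p q : ℕ}

theorem sum_smul_bend {F : List (Γ × n) → B} {f : List (Γ × n) → ℂ} {k : Fin p → Γ}
    {l : Fin q → Γ} (hf : IsNC (colorWord k l) f) :
    ∑ y ∈ words (Γ × n) (p + q), f y • F y = ∑ i, ∑ j, f (bend k l i j) • F (bend k l i j) :=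
  sum_words_eq_sum_bend k l _ fun y hy => hf.color fun h => hy (by rw [h, zero_smul])

theorem tensorPow_eq_tensorCoeff {u : Matrix n n B} {γ : Color → Γ}
    (hu : ∀ c, coloredFund u c = v (γ c)) (k : Fin p → Color) (i j : Fin p → n) :
    tensorPow u k i j = tensorCoeff v (letters (γ ∘ k) i) (letters (γ ∘ k) j) := by
  rw [tensorPow, Matrix.of_apply]
  simp only [hu, letters]
  induction p with
  | zero => simp [tensorCoeff_nil]
  | succ p ih =>
    simp only [List.ofFn_succ, List.prod_cons, tensorCoeff_cons, if_true]
    rw [ih (fun a => k a.succ) (fun a => i a.succ) fun a => j a.succ]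
    rfl

theorem tensorPow_mul_conjTranspose (hv : IsColoredUnitary Duality.dual v) {u : Matrix n n B}
    {γ : Color → Γ} (hu : ∀ c, coloredFund u c = v (γ c)) (k : Fin p → Color) :
    tensorPow u k * (tensorPow u k)ᴴ = 1 := by
  ext i j
  simp only [Matrix.mul_apply, Matrix.conjTranspose_apply, tensorPow_eq_tensorCoeff hu]
  rw [← sum_words_eq_sum_letters (γ ∘ k) fun y => tensorCoeff v (letters (γ ∘ k) i) y *
    star (tensorCoeff v (letters (γ ∘ k) j) y), sum_tensorCoeff_mul_star hv (length_letters _ _)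
    (length_letters _ _), Matrix.one_apply]
  · simp only [(letters_injective (γ ∘ k)).eq_iff]
  · intro y hy h
    rw [← map_fst_letters (γ ∘ k) i]
    exact (map_fst_eq_of_tensorCoeff_ne_zero (by rw [hy, length_letters])
      (left_ne_zero_of_mul h)).symm

theorem conjTranspose_mul_tensorPow (hv : IsColoredUnitary Duality.dual v) {u : Matrix n n B}
    {γ : Color → Γ} (hu : ∀ c, coloredFund u c = v (γ c)) (k : Fin p → Color) :
    (tensorPow u k)ᴴ * tensorPow u k = 1 := by
  ext i j
  simp only [Matrix.mul_apply, Matrix.conjTranspose_apply, tensorPow_eq_tensorCoeff hu]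
  rw [← sum_words_eq_sum_letters (γ ∘ k) fun y => star (tensorCoeff v y (letters (γ ∘ k) i)) *
    tensorCoeff v y (letters (γ ∘ k) j), sum_star_mul_tensorCoeff hv (length_letters _ _)
    (length_letters _ _), Matrix.one_apply]
  · simp only [(letters_injective (γ ∘ k)).eq_iff]
  · intro y hy h
    rw [← map_fst_letters (γ ∘ k) j]
    exact map_fst_eq_of_tensorCoeff_ne_zero (by rw [hy, length_letters])
      (right_ne_zero_of_mul h)

/-- Multiply `T V = W T` by `Vᴴ` on the right and take adjoints. The adjoint puts the upper row
first, in agreement with `bend`. -/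
theorem mem_Hom_iff_conj [StarModule ℂ B] {m r : Type*} [Fintype m] [Fintype r] [DecidableEq m]
    [DecidableEq r] {V : Matrix r r B} {W : Matrix m m B} (h1 : V * Vᴴ = 1) (h2 : Vᴴ * V = 1)
    (T : Matrix m r ℂ) :
    T ∈ Hom V W ↔ V * Tᴴ.map (algebraMap ℂ B) * Wᴴ = Tᴴ.map (algebraMap ℂ B) := by
  have h3 : Tᴴ.map (algebraMap ℂ B) = (T.map (algebraMap ℂ B))ᴴ := by
    ext i j
    exact algebraMap_star_comm (T j i)
  have h4 : V * (T.map (algebraMap ℂ B))ᴴ * Wᴴ = (W * T.map (algebraMap ℂ B) * Vᴴ)ᴴ := by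
    simp [Matrix.conjTranspose_mul, Matrix.mul_assoc]
  rw [h3, h4, Matrix.conjTranspose_inj]
  change T.map (algebraMap ℂ B) * V = W * T.map (algebraMap ℂ B) ↔ _
  constructor
  · intro h
    rw [← h, Matrix.mul_assoc, h1, Matrix.mul_one]
  · intro h
    conv_lhs => rw [← h]
    rw [Matrix.mul_assoc, h2, Matrix.mul_one]

theorem mem_Hom_tensorPow_iff [StarModule ℂ B] (hv : IsColoredUnitary Duality.dual v)
    {u : Matrix n n B} {γ : Color → Γ} (hu : ∀ c, coloredFund u c = v (γ c)) (k : Fin p → Color)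
    (l : Fin q → Color) (T : Matrix (Fin q → n) (Fin p → n) ℂ) :
    T ∈ Hom (tensorPow u k) (tensorPow u l) ↔ ∀ i j,
      ∑ i', ∑ j', Tᴴ i' j' • tensorCoeff v (bend (γ ∘ k) (γ ∘ l) i j)
        (bend (γ ∘ k) (γ ∘ l) i' j') = Tᴴ i j • 1 := by
  rw [mem_Hom_iff_conj (tensorPow_mul_conjTranspose hv hu k) (conjTranspose_mul_tensorPow hv hu k),
    ← Matrix.ext_iff]
  refine forall_congr' fun i => forall_congr' fun j => ?_
  have h1 : ∀ i' j', tensorCoeff v (bend (γ ∘ k) (γ ∘ l) i j) (bend (γ ∘ k) (γ ∘ l) i' j') =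
      tensorPow u k i i' * star (tensorPow u l j j') := fun i' j' => by
    rw [tensorPow_eq_tensorCoeff hu, tensorPow_eq_tensorCoeff hu,
      star_tensorCoeff hv (by simp [length_letters]), bend, bend,
      tensorCoeff_append (by simp [length_letters])]
  simp only [h1, Matrix.mul_apply, Matrix.map_apply, Matrix.conjTranspose_apply (tensorPow u l),
    Finset.sum_mul, Algebra.algebraMap_eq_smul_one, mul_smul_comm, mul_one, smul_mul_assoc]
  rw [Finset.sum_comm]

end Fixed

/-! ### The Brauer theorem for a general set of colors -/

section Brauer

variable {Γ : Type} {A : Type*} [Duality Γ] [DecidableEq Γ] [Fintype Γ] [Ring A] [StarRing A]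
  [Algebra ℂ A] [StarModule ℂ A] {N p q : ℕ} {v : Γ → Matrix (Fin N) (Fin N) A}

/-- The fixed space involves all color words of the given length, but unbending evaluates only at
words of colors `colorWord k l`, and so kills the other generators. -/
theorem unbend_mem_span {k : Fin p → Γ} {l : Fin q → Γ} {f : List (Γ × Fin N) → ℂ}
    (hf : f ∈ fixSpace Γ (Fin N) (p + q)) :
    (unbend (Fin N) k l f)ᴴ ∈ Submodule.span ℂ
      ((fun π => Pairing.T π N) '' {π | π.IsNoncrossing ∧ π.JoinsDual k l}) := by
  induction hf using Submodule.span_induction with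
  | mem f hf =>
    obtain ⟨w, -, hf⟩ := hf
    by_cases hw : w = colorWord k l
    · subst hw
      obtain ⟨π, h1, h2, h3⟩ := hf.exists_unbend_eq
      rw [h3, Matrix.conjTranspose_conjTranspose]
      exact Submodule.subset_span ⟨π, ⟨h1, h2⟩, rfl⟩
    · have : unbend (Fin N) k l f = 0 := by
        ext i j
        by_contra h
        exact hw ((hf.color h).symm.trans (map_fst_bend k l i j))
      rw [this, Matrix.conjTranspose_zero]
      exact zero_mem _
  | zero => simp
  | add f g _ _ hf hg =>
    rw [map_add, Matrix.conjTranspose_add]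
    exact add_mem hf hg
  | smul r f _ hf =>
    rw [map_smul, Matrix.conjTranspose_smul]
    exact Submodule.smul_mem _ _ hf

/-- The Brauer theorem for an algebra which is represented on the Hilbert space of the vacuum
state. -/
theorem Hom_tensorPow_eq_span (hv : IsColoredUnitary Duality.dual v) {u : Matrix (Fin N) (Fin N) A}
    {γ : Color → Γ} (hu : ∀ c, coloredFund u c = v (γ c))
    (φ : A →ₐ[ℂ] (GNS Γ (Fin N) →L[ℂ] GNS Γ (Fin N)))
    (hφ : ∀ c i j, φ (v c i j) = gnsGen Γ (Fin N) c i j) (k : Fin p → Color)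
    (l : Fin q → Color) :
    Hom (tensorPow u k) (tensorPow u l) = Submodule.span ℂ ((fun π => Pairing.T π N) ''
      {π | π.IsNoncrossing ∧ π.JoinsDual (γ ∘ k) (γ ∘ l)}) := by
  apply le_antisymm
  · intro T hT
    rw [mem_Hom_tensorPow_iff hv hu] at hT
    -- This is the projection of the bent `Tᴴ` onto the noncrossing span; it remains to see that it
    -- is `Tᴴ` itself.
    set f : List (Γ × Fin N) → ℂ := ∑ i', ∑ j', Tᴴ i' j' •
      fun x => fixProj Γ (Fin N) (p + q) x (bend (γ ∘ k) (γ ∘ l) i' j') with hf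
    have hfm : f ∈ fixSpace Γ (Fin N) (p + q) :=
      sum_mem fun i' _ => sum_mem fun j' _ => Submodule.smul_mem _ _ (fixProj_mem _ _)
    have hfT : unbend (Fin N) (γ ∘ k) (γ ∘ l) f = Tᴴ := by
      ext i j
      -- The vacuum state, applied to the fixed vector equation, replaces each coefficient by an
      -- entry of the projection.
      have h := congrArg (fun a => inner ℂ (vacuum Γ (Fin N)) (φ a (vacuum Γ (Fin N)))) (hT i j)
      simp only [map_sum, map_smul, map_one, sum_apply, smul_apply,
        inner_sum, inner_smul_right, one_apply_eq_self, inner_vacuum_vacuum,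
        mul_one] at h
      rw [← h, unbend_apply, hf]
      simp only [Finset.sum_apply, Pi.smul_apply, smul_eq_mul]
      refine Finset.sum_congr rfl fun i' _ => Finset.sum_congr rfl fun j' _ => ?_
      rw [map_tensorCoeff φ hφ (by simp [length_bend]),
        inner_vacuum_tensorCoeff (by simp [map_fst_bend]), haar, length_bend]
    have := unbend_mem_span (k := γ ∘ k) (l := γ ∘ l) hfm
    rwa [hfT, Matrix.conjTranspose_conjTranspose] at this
  · rw [Submodule.span_le]
    rintro _ ⟨π, ⟨h1, h2⟩, rfl⟩
    refine (mem_Hom_tensorPow_iff hv hu k l _).2 fun i j => ?_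
    obtain ⟨f, hf, h⟩ := h1.exists_isNC h2 N
    simp only [← h, unbend_apply]
    rw [← sum_smul_bend (F := tensorCoeff v (bend (γ ∘ k) (γ ∘ l) i j)) hf]
    have := hf.sum_smul_tensorCoeff hv (x := bend (γ ∘ k) (γ ∘ l) i j)
      (by rw [length_bend, length_colorWord])
    rwa [length_colorWord] at this

end Brauer

/-! ### The universal algebras -/

section Universal

variable {ι : Type} {R : Relations ι}

/-- The representation of the universal algebra given by a realization of the relations. -/
def evalAt (ρ : Realization R) : UnivCStar R →⋆ₐ[ℂ] ρ.B where
  toFun a := (a : univSubalgebra R).1 ρ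
  map_one' := rfl
  map_mul' _ _ := rfl
  map_zero' := rfl
  map_add' _ _ := rfl
  commutes' _ := rfl
  map_star' _ := rfl

/-- The universal algebra sits inside the product of all realizations, so evaluations separate its
points. The relations for the generators can thus be checked in each realization. -/
theorem univ_ext {a b : UnivCStar R} (h : ∀ ρ : Realization R, evalAt ρ a = evalAt ρ b) : a = b :=
  Subtype.ext (lp.ext (funext h))

theorem isColoredUnitary_of_evalAt {Γ n : Type} [Fintype n] [DecidableEq n] {dual : Γ → Γ}
    {v : Γ → Matrix n n (UnivCStar R)}
    (h : ∀ ρ : Realization R, IsColoredUnitary dual fun c => (v c).map (evalAt ρ)) :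
    IsColoredUnitary dual v where
  star_apply c i j := univ_ext fun ρ => by
    rw [map_star]
    exact (h ρ).star_apply c i j
  sum_row c i j := univ_ext fun ρ => by
    have := (h ρ).sum_row c i j
    simp only [Matrix.map_apply] at this
    rw [map_sum, apply_ite (evalAt ρ), map_one, map_zero, ← this]
    exact Finset.sum_congr rfl fun k _ => map_mul _ _ _
  sum_col c i j := univ_ext fun ρ => by
    have := (h ρ).sum_col c i j
    simp only [Matrix.map_apply] at this
    rw [map_sum, apply_ite (evalAt ρ), map_one, map_zero, ← this]
    exact Finset.sum_congr rfl fun k _ => map_mul _ _ _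

end Universal

/-! ### The two cases: one self-dual color, and two exchanged colors -/

instance : Duality Unit := ⟨id, fun _ => rfl⟩

instance : DecidableEq Color
  | .white, .white => isTrue rfl
  | .black, .black => isTrue rfl
  | .white, .black => isFalse fun h => nomatch h
  | .black, .white => isFalse fun h => nomatch h

instance : Fintype Color := ⟨{.white, .black}, fun c => by cases c <;> simp⟩

/-- The exchange of the two colors. -/
def Color.swap : Color → Color
  | .white => .black
  | .black => .white

instance : Duality Color := ⟨Color.swap, fun c => by cases c <;> rfl⟩

theorem Color.eq_swap_iff (c d : Color) : c = d.swap ↔ d ≠ c := by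
  cases c <;> cases d <;> simp [Color.swap]

/-- Conjugating the lower row turns equal colors on a through string into dual ones, while opposite
colors on one row stay opposite. -/
theorem Pairing.joinsDual_iff_isMatching {p q : ℕ} (π : Pairing p q) (k : Fin p → Color)
    (l : Fin q → Color) : π.JoinsDual k l ↔ π.IsMatching k l := by
  have hs : ∀ c d : Color, c.swap = d.swap ↔ d = c := fun c d => by
    cases c <;> cases d <;> simp [Color.swap]
  have hs' : ∀ c d : Color, c.swap = d.swap.swap ↔ d ≠ c := fun c d => by
    cases c <;> cases d <;> simp [Color.swap]
  constructor
  · intro h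
    refine ⟨fun a b e => ?_, fun a b e => ?_, fun a b e => ?_⟩
    · have := h (.inl a)
      rw [e] at this
      exact (Color.eq_swap_iff _ _).1 this
    · have := h (.inr a)
      rw [e] at this
      exact (hs' _ _).1 this
    · have := h (.inl a)
      rw [e] at this
      exact (hs _ _).1 this
  · rintro ⟨h1, h2, h3⟩ (a | a)
    · rcases e : π.partner (.inl a) with b | b
      · exact (Color.eq_swap_iff _ _).2 (h1 a b e)
      · exact (hs _ _).2 (h3 a b e)
    · rcases e : π.partner (.inr a) with b | b
      · have e' : π.partner (.inl b) = .inr a := by rw [← e, π.partner_partner]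
        have : k b = (l a).swap.swap := by
          rw [h3 b a e']
          cases l a <;> rfl
        exact this
      · exact (hs' _ _).2 (h2 a b e)

theorem IsOrthogonal.isColoredUnitary {n B : Type*} [Fintype n] [DecidableEq n] [Ring B]
    [StarRing B] {u : Matrix n n B} (hu : IsOrthogonal u) :
    IsColoredUnitary (Duality.dual : Unit → Unit) fun _ => u where
  star_apply _ i j := (congrFun (congrFun hu.1 i) j).symm
  sum_row _ i j := by
    have := congrFun (congrFun hu.2.2 i) j
    simpa [Matrix.mul_apply, Matrix.one_apply] using this
  sum_col _ i j := by
    have := congrFun (congrFun hu.2.1 i) j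
    simpa [Matrix.mul_apply, Matrix.one_apply] using this

theorem IsBiunitary.isColoredUnitary {n B : Type*} [Fintype n] [DecidableEq n] [Ring B]
    [StarRing B] {u : Matrix n n B} (hu : IsBiunitary u) :
    IsColoredUnitary (Duality.dual : Color → Color) (coloredFund u) := by
  obtain ⟨⟨h1, h2⟩, h3, h4⟩ := hu
  refine ⟨fun c i j => ?_, fun c i j => ?_, fun c i j => ?_⟩
  · cases c
    · rfl
    · exact star_star _
  · cases c
    · have := congrFun (congrFun h2 i) j
      rw [Matrix.mul_apply, Matrix.one_apply] at this
      exact this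
    · have := congrFun (congrFun h4 i) j
      rw [Matrix.mul_apply, Matrix.one_apply] at this
      exact this
  · cases c
    · have := congrFun (congrFun h3 i) j
      rw [Matrix.mul_apply, Matrix.one_apply] at this
      exact this
    · have := congrFun (congrFun h1 i) j
      rw [Matrix.mul_apply, Matrix.one_apply] at this
      exact this

/-- The realization of `C(O_N⁺)` on the Hilbert space of the vacuum state. -/
def orthogonalRealization (N : ℕ) : Realization (orthogonalRelations N) where
  B := GNS Unit (Fin N) →L[ℂ] GNS Unit (Fin N)
  x ij := gnsGen Unit (Fin N) () ij.1 ij.2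
  holds := by
    have h := gnsGen_isColoredUnitary (Γ := Unit) (n := Fin N)
    refine ⟨?_, ?_, ?_⟩
    · ext1 i j
      exact (h.star_apply () i j).symm
    · ext1 i j
      rw [Matrix.one_apply, ← h.sum_col ()]
      rfl
    · ext1 i j
      rw [Matrix.one_apply, ← h.sum_row ()]
      rfl

/-- The realization of `C(U_N⁺)` on the Hilbert space of the vacuum state. -/
def unitaryRealization (N : ℕ) : Realization (unitaryRelations N) where
  B := GNS Color (Fin N) →L[ℂ] GNS Color (Fin N)
  x ij := gnsGen Color (Fin N) .white ij.1 ij.2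
  holds := by
    have h := gnsGen_isColoredUnitary (Γ := Color) (n := Fin N)
    have hs : ∀ i j, star (gnsGen Color (Fin N) .white i j) = gnsGen Color (Fin N) .black i j :=
      fun i j => h.star_apply .white i j
    refine ⟨⟨?_, ?_⟩, ?_, ?_⟩ <;> ext1 i j
    · rw [Matrix.one_apply, ← h.sum_col .black, Matrix.mul_apply]
      exact Finset.sum_congr rfl fun k _ => congrArg (· * _) (hs k i)
    · rw [Matrix.one_apply, ← h.sum_row .white, Matrix.mul_apply]
      exact Finset.sum_congr rfl fun k _ => congrArg (_ * ·) (hs j k)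
    · rw [Matrix.one_apply, ← h.sum_col .white, Matrix.mul_apply]
      exact Finset.sum_congr rfl fun k _ => congrArg (_ * ·) (hs k j)
    · rw [Matrix.one_apply, ← h.sum_row .black, Matrix.mul_apply]
      exact Finset.sum_congr rfl fun k _ => congrArg (· * _) (hs i k)

theorem fundO_isColoredUnitary (N : ℕ) :
    IsColoredUnitary (Duality.dual : Unit → Unit) fun _ => fundO N :=
  isColoredUnitary_of_evalAt fun ρ => ρ.holds.isColoredUnitary

theorem map_coloredFund {n A B : Type*} [Star A] [Star B] {F : Type*} [FunLike F A B]
    [StarHomClass F A B] (φ : F) (u : Matrix n n A) (c : Color) :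
    (coloredFund u c).map φ = coloredFund (u.map φ) c := by
  cases c
  · rfl
  · ext i j
    exact map_star φ _

theorem fundU_isColoredUnitary (N : ℕ) :
    IsColoredUnitary (Duality.dual : Color → Color) (coloredFund (fundU N)) :=
  isColoredUnitary_of_evalAt fun ρ => by
    simp only [map_coloredFund]
    exact ρ.holds.isColoredUnitary

theorem evalAt_fundU (N : ℕ) (c : Color) (i j : Fin N) :
    evalAt (unitaryRealization N) (coloredFund (fundU N) c i j) = gnsGen Color (Fin N) c i j := by
  cases c
  · rfl
  · have h1 : coloredFund (fundU N) .black i j = star (fundU N i j) := rfl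
    have h2 := (gnsGen_isColoredUnitary (Γ := Color) (n := Fin N)).star_apply .white i j
    rw [h1, map_star]
    exact h2

end FreeQG

end

theorem theorem4p28 (N : ℕ) {p q : ℕ} (k : Fin p → FreeQG.Color) (l : Fin q → FreeQG.Color) :
    FreeQG.Hom (FreeQG.tensorPow (FreeQG.fundO N) k) (FreeQG.tensorPow (FreeQG.fundO N) l) =
        Submodule.span ℂ ((fun π => FreeQG.Pairing.T π N) '' FreeQG.NC2 k l) ∧
      FreeQG.Hom (FreeQG.tensorPow (FreeQG.fundU N) k) (FreeQG.tensorPow (FreeQG.fundU N) l) =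
        Submodule.span ℂ ((fun π => FreeQG.Pairing.T π N) '' FreeQG.MNC2 k l) := by
  open FreeQG in
  constructor
  · have hv := fundO_isColoredUnitary N
    -- Both colors go to the single self-dual one because `ū = u`; the color condition on strings
    -- then holds trivially, leaving all noncrossing pairings.
    rw [Hom_tensorPow_eq_span (γ := fun _ => ()) hv (fun c => ?_)
      (evalAt (orthogonalRealization N)).toAlgHom (fun _ _ _ => rfl) k l]
    · congr 2
      ext π
      exact ⟨fun h => h.1, fun h => ⟨h, fun _ => rfl⟩⟩
    · cases c
      · rfl
      · ext i j
        exact hv.star_apply () i j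
  · have hv := fundU_isColoredUnitary N
    rw [Hom_tensorPow_eq_span (γ := id) hv (fun _ => rfl)
      (evalAt (unitaryRealization N)).toAlgHom (evalAt_fundU N) k l]
    congr 2
    ext π
    exact and_congr_right fun _ => π.joinsDual_iff_isMatching k l
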